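/- **Setting.** Let $\mathcal S$ be a set of states, $P$ a (discrete) transition function on $\mathcal S$, $s_0\in\mathcal S$, and $H\ge 1$ a horizon. A random trajectory $\tau=(s_0,\dots,s_H)$ starts in $s_0$ and makes $H$ transitions according to $P$; it is also regarded as the set of its states. For $F\subseteq\mathcal S$ let $\Delta(F)=\Pr_\tau[\tau\not\subseteq F]$; $F$ is $\rho$-safe if $\Delta(F)\le\rho$, and $k^*=k^*(\rho)$ is the smallest size of a $\rho$-safe set. **Algorithm.** *Finding SafeZone* with parameters $\rho,\epsilon,\lambda$ starts with $F=\{s_0\}$, $j=1$, $\widehat\Delta=1$. While $\widehat\Delta>2\rho+\epsilon$ it samples a trajectory $\tau$ and puts $n=|\tau\setminus F|$. If $n\neq0$ then with probability $1/n$ it accepts $\tau$, that is, it replaces $F$ by $F\cup\tau$, sets $\lambda_j=\frac{3\lambda}{2(j\pi)^2}$, increases $j$ by one, and lets $\widehat\Delta$ be the fraction of $\lceil\frac1{2\epsilon^2}\ln\frac2{\lambda_j}\rceil$ fresh random trajectories that escape $F$. After the loop it returns $F$. Let the *variant with initial estimate* be the same algorithm, except that the initial value of $\widehat\Delta$ is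 produced by the estimation subroutine for $F=\{s_0\}$ with confidence $\lambda_1$ (and $j$ continues from $2$). The sample complexity is the number of sampled trajectories. The running time is the number of elementary steps, where observing a trajectory takes $H+1$ steps, and testing membership of one state in a table, inserting one state into a table, reading the size of a table, a Bernoulli draw, and a constant number of arithmetic operations take one step each. **Theorem.** There are absolute constants $a,C>0$ such that the following holds for all Markov chains as above with $H\ge1$, all $\rho\in(0,1)$, $\epsilon>0$ and $\delta\in(0,1)$. Put $m=\lceil a/\delta\rceil=\Theta(1/\delta)$ and $\lambda=\frac{0.01}{3m}$. (A) Assume that $\Delta(\{s_0\})\ge 2\rho$ or $2\rho+\epsilon\ge1$. Run Finding SafeZone independently $m$ times and return the smallest output set $F$. Then with probability at least $0.99$ all runs terminate and all of the following hold: 1. $\Delta(F)\le 2\rho+2\epsilon$; 2. $|F|\le(2+\delta)k^*$; 3. the total number of samples is at most $C\left(\frac{k^*}{\delta^2\epsilon^2}\ln\frac{k^*}{\delta}+\frac{Hk^*}{\rho\delta^2}\right)$ and the total running time is at most $C\left(\frac{Hk^*}{\delta^2\epsilon^2}\ln\frac{k^*}{\delta}+\frac{H^2k^*}{\rho\delta^2}\right)$.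 (B) Without any assumption on $\Delta(\{s_0\})$, the same holds for the variant with initial estimate, with $\ln\frac{2k^*}{\delta}$ in place of $\ln\frac{k^*}{\delta}$. -/

import Mathlib

open scoped ENNReal NNReal

universe u v

noncomputable section

namespace SafeZone

/-! ### Markov chains, trajectories, safe sets -/

/-- A Markov chain with transition function `P`, initial state `s₀` and finite horizon `H`. -/
structure MarkovModel (S : Type u) where
  P : S → PMF S
  s₀ : S
  H : ℕ

/-- Law of the list `[s, s₁, …, sₙ]` formed by `s` and the next `n` states of the chain. -/
def pathLaw {S : Type u} (P : S → PMF S) : ℕ → S → PMF (List S)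
  | 0, s => PMF.pure [s]
  | n + 1, s => (P s).bind fun s' => (pathLaw P n s').map fun τ => s :: τ

/-- Law of a random trajectory `(s₀, …, s_H)`. -/
def MarkovModel.trajLaw {S : Type u} (M : MarkovModel S) : PMF (List S) :=
  pathLaw M.P M.H M.s₀

/-- The escape probability `Δ(F) = Pr[τ ⊈ F]`. -/
def escapeProb {S : Type u} (M : MarkovModel S) (F : Set S) : ℝ :=
  (M.trajLaw.toOuterMeasure {τ | ¬ ∀ s ∈ τ, s ∈ F}).toReal

/-- `F` is `ρ`-safe. -/
def IsSafe {S : Type u} (M : MarkovModel S) (ρ : ℝ) (F : Set S) : Prop :=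
  escapeProb M F ≤ ρ

/-- `k*(ρ)`: the smallest size of a `ρ`-safe set (for `ρ > 0` a finite `ρ`-safe set exists,
even when `S` is infinite). -/
def kStar {S : Type u} (M : MarkovModel S) (ρ : ℝ) : ℕ :=
  sInf {k | ∃ F : Finset S, IsSafe M ρ (F : Set S) ∧ F.card = k}

/-! ### Randomized computations that count their samples and their elementary steps -/

/-- Resources used by a computation: number of sampled trajectories, number of steps. -/
@[ext]
structure Cost where
  samples : ℕ
  steps : ℕ

instance : Zero Cost := ⟨⟨0, 0⟩⟩

instance : Add Cost := ⟨fun c d => ⟨c.samples + d.samples, c.steps + d.steps⟩⟩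

/-- A randomized computation: the joint law of its result and of the resources it used. -/
abbrev Prog (α : Type u) : Type u := PMF (α × Cost)

namespace Prog

/-- Return a value at no cost. -/
def ret {α : Type u} (a : α) : Prog α := PMF.pure (a, 0)

/-- Sequential composition, with fresh randomness; the costs add up. -/
def andThen {α : Type u} {β : Type v} (x : Prog α) (f : α → Prog β) : Prog β :=
  PMF.bind x fun r => PMF.map (fun t => (t.1, r.2 + t.2)) (f r.1)

/-- A primitive operation with law `p` and a fixed cost `c`. -/
def prim {α : Type u} (p : PMF α) (c : Cost) : Prog α := PMF.map (fun a => (a, c)) p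

/-- A constant number of arithmetic operations, comparisons or assignments: one step. -/
def compute {α : Type u} (a : α) : Prog α := prim (PMF.pure a) ⟨0, 1⟩

end Prog

open Prog

/-! The remaining primitives. Sets of states are kept in lookup tables that also store their
own size: testing whether one state belongs to a table, inserting one state into a table,
and reading the size of a table take one step each. -/

/-- Observe one random trajectory: one sample, and one step for each of its `H + 1` states. -/
def sampleTraj {S : Type u} (M : MarkovModel S) : Prog (List S) :=
  prim M.trajLaw ⟨1, M.H + 1⟩

open Classical in
/-- Test whether `s` is in the table `T`. -/
def tableLookup {S : Type u} (T : Finset S) (s : S) : Prog Bool :=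
  prim (PMF.pure (decide (s ∈ T))) ⟨0, 1⟩

open Classical in
/-- Insert `s` into the table `T`. -/
def tableInsert {S : Type u} (T : Finset S) (s : S) : Prog (Finset S) :=
  prim (PMF.pure (insert s T)) ⟨0, 1⟩

/-- Read the size of the table `T`. -/
def tableSize {S : Type u} (T : Finset S) : Prog ℕ :=
  prim (PMF.pure T.card) ⟨0, 1⟩

/-- A Bernoulli variable with parameter `1 / k` (used for `k ≥ 1`). -/
def coin (k : ℕ) : Prog Bool :=
  prim (PMF.ofFintype
    (fun b : Bool => ((cond b (k : ℝ≥0)⁻¹ (1 - (k : ℝ≥0)⁻¹) : ℝ≥0) : ℝ≥0∞))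
    (by simp [Nat.cast_inv_le_one k])) ⟨0, 1⟩

/-! ### The algorithm -/

/-- Scan the trajectory and add to `N` its states outside `F`; started at `N = ∅` this collects
the set `τ \ F`, whose size is `new_F(τ)`. -/
def newStates {S : Type u} (F : Finset S) : List S → Finset S → Prog (Finset S)
  | [], N => ret N
  | s :: τ, N =>
      andThen (tableLookup F s) fun inF =>
      andThen (tableLookup N s) fun inN =>
      if inF || inN then newStates F τ N
      else andThen (tableInsert N s) fun N' => newStates F τ N'

/-- `F ∪ τ`, one insertion per entry of `τ`. -/
def addStates {S : Type u} : List S → Finset S → Prog (Finset S)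
  | [], F => ret F
  | s :: τ, F => andThen (tableInsert F s) fun F' => addStates τ F'

/-- Decide whether `τ ⊈ F`. -/
def escapes {S : Type u} (F : Finset S) : List S → Prog Bool
  | [] => ret false
  | s :: τ => andThen (tableLookup F s) fun inF => if inF then escapes F τ else ret true

/-- Sample `n` trajectories and add to `c` the number of those that escape `F`. -/
def countEscapes {S : Type u} (M : MarkovModel S) (F : Finset S) : ℕ → ℕ → Prog ℕ
  | 0, c => ret c
  | n + 1, c =>
      andThen (sampleTraj M) fun τ =>
      andThen (escapes F τ) fun e =>
      andThen (compute (if e then c + 1 else c)) fun c' => countEscapes M F n c'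

/-- Number of trajectories that the subroutine samples at accuracy `ε` and confidence `l`. -/
def estSamples (ε l : ℝ) : ℕ := ⌈1 / (2 * ε ^ 2) * Real.log (2 / l)⌉₊

/-- The subroutine *EstSafety*: the fraction of the sampled trajectories that escape `F`. -/
def estSafety {S : Type u} (M : MarkovModel S) (ε l : ℝ) (F : Finset S) : Prog ℝ :=
  andThen (compute (estSamples ε l)) fun N =>
  andThen (countEscapes M F N 0) fun c => compute ((c : ℝ) / (N : ℝ))

/-- The confidence `λ_j = 3 λ / (2 (j π)²)` of the `j`-th estimate. -/
def lamSeq (lam : ℝ) (j : ℕ) : ℝ := 3 * lam / (2 * ((j : ℝ) * Real.pi) ^ 2)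

open Classical in
/-- The while-loop, with current set `F`, index `j` and estimate `d`, cut off (with result
`none`) if it has not terminated when its condition has been tested `fuel` times. -/
def mainLoop {S : Type u} (M : MarkovModel S) (ρ ε lam : ℝ) :
    (fuel : ℕ) → Finset S → ℕ → ℝ → Prog (Option (Finset S))
  | 0, _, _, _ => ret none
  | fuel + 1, F, j, d =>
      andThen (compute (decide (d > 2 * ρ + ε))) fun continues =>
      if continues then
        andThen (sampleTraj M) fun τ =>
        andThen (newStates F τ ∅) fun N =>
        andThen (tableSize N) fun k =>
        andThen (compute (decide (k ≠ 0))) fun hasNew =>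
        if hasNew then
          andThen (coin k) fun accept =>
          if accept then
            andThen (addStates τ F) fun F' =>
            andThen (compute (lamSeq lam j)) fun l =>
            andThen (compute (j + 1)) fun j' =>
            andThen (estSafety M ε l F') fun d' =>
            mainLoop M ρ ε lam fuel F' j' d'
          else mainLoop M ρ ε lam fuel F j d
        else mainLoop M ρ ε lam fuel F j d
      else ret (some F)

/-- *Finding SafeZone*, started with `F = {s₀}`, `j = 1` and the value `1` as initial
estimate of `Δ(F)`. -/
def findSafeZone {S : Type u} (M : MarkovModel S) (ρ ε lam : ℝ) (fuel : ℕ) :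
    Prog (Option (Finset S)) :=
  andThen (tableInsert ∅ M.s₀) fun F =>
  andThen (compute (1 : ℕ)) fun j =>
  andThen (compute (1 : ℝ)) fun d =>
  mainLoop M ρ ε lam fuel F j d

/-- *Finding SafeZone* in the form in which `Δ({s₀})` is estimated as well: the initial
estimate is produced by the subroutine at confidence `λ₁`, and `j` continues from `2`. -/
def findSafeZoneEst {S : Type u} (M : MarkovModel S) (ρ ε lam : ℝ) (fuel : ℕ) :
    Prog (Option (Finset S)) :=
  andThen (tableInsert ∅ M.s₀) fun F =>
  andThen (compute (lamSeq lam 1)) fun l =>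
  andThen (compute (2 : ℕ)) fun j =>
  andThen (estSafety M ε l F) fun d =>
  mainLoop M ρ ε lam fuel F j d

/-- Run `alg` another `n` times, and keep the smallest among the outputs and `best`. -/
def keepSmallest {S : Type u} (alg : Prog (Option (Finset S))) :
    ℕ → Finset S → Prog (Option (Finset S))
  | 0, best => ret (some best)
  | n + 1, best =>
      andThen alg fun out =>
      match out with
      | none => ret none
      | some F =>
          andThen (tableSize F) fun a =>
          andThen (tableSize best) fun b =>
          andThen (compute (if a < b then F else best)) fun best' =>
          keepSmallest alg n best'

/-- Run `alg` independently `m ≥ 1` times and return the smallest output; `none` if one of the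
runs was cut off. -/
def smallestOf {S : Type u} (alg : Prog (Option (Finset S))) (m : ℕ) :
    Prog (Option (Finset S)) :=
  andThen alg fun out =>
  match out with
  | none => ret none
  | some F => keepSmallest alg (m - 1) F

/-- Probability that a computation with possibly unbounded loops terminates with an output and
a total cost that satisfy `good`: the supremum (limit) over the cut-off. -/
def haltProb {α : Type u} (prog : ℕ → Prog (Option α)) (good : α → Cost → Prop) : ℝ≥0∞ :=
  ⨆ fuel, (prog fuel).toOuterMeasure {r | ∃ a, r.1 = some a ∧ good a r.2}

end SafeZone

end

open SafeZone

/-! Fix a smallest `ρ`-safe set `G`, of size `k`. Consider an iteration in which `Δ(F) ≥ 2ρ`.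
Acceptance with probability `1/n` gives every escaping trajectory exactly one new state in
expectation, so `F` grows on average by `Δ(F)`. If the trajectory also stays in `G`, all its new
states lie in `G`; this event has probability at least `Δ(F) - ρ ≥ Δ(F)/2`. Hence at least half of
the expected growth is progress inside `G`, and the expected progress is at least `ρ`
(`expected_gain`). As `G` has only `k` states, on average the loop makes at most about `k/ρ`
iterations, accepts about `2k` trajectories and outputs at most `2k` states.

The three averages come from one potential `loopPot`, linear in the number of missing states of `G`,
with free weights `w₁` for failure, `w₂` for output states and `w₃` for samples
(`expect_iteration_le`, `val_guardedLoop_le`). Setting one weight to `1` and the others to `0` gives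
each bound (`averageBounds_of_val_le`).

The argument needs accurate estimates: if each is within `ε`, the loop continues only while `Δ(F) ≥
2ρ` and stops only when `Δ(F) ≤ 2ρ + 2ε`. `guardedLoop` therefore aborts as soon as an estimate is
bad (Hoeffding, with error probabilities summing to at most `λ`) or too many trajectories are
accepted. Aborting only loses outcomes, so probabilities of success proved for guarded runs transfer
to the algorithm (`Dominated`). For guarded runs the safety of the output and a running time linear
in the number of samples hold surely (`SureBounds`).

Finally `m` runs are combined in `le_haltProb_smallestOf`. By Markov one output exceeds `(2+δ)k`
with probability at most `2/(2+δ)`, so all of them do with probability at most `(2/(2+δ))^m ≤ e⁻¹⁰`.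
A union bound over failures and Markov for the total number of samples complete the error budget
`0.006 + 0.002 + 0.002 = 0.01`. -/

noncomputable section

namespace SafeZone

open Prog

/-! ### Expectations under discrete laws, with values in `ℝ≥0∞`. -/

section Expectation

variable {α : Type u} {β : Type v}

/-- The expectation of a nonnegative function under a discrete law. -/
def expect (p : PMF α) (f : α → ℝ≥0∞) : ℝ≥0∞ := ∑' a, p a * f a

lemma expect_mono_of_support {p : PMF α} {f g : α → ℝ≥0∞} (h : ∀ a, p a ≠ 0 → f a ≤ g a) :
    expect p f ≤ expect p g := by
  refine ENNReal.tsum_le_tsum fun a => ?_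
  by_cases ha : p a = 0
  · simp [ha]
  · gcongr
    exact h a ha

lemma expect_mono {p : PMF α} {f g : α → ℝ≥0∞} (h : ∀ a, f a ≤ g a) :
    expect p f ≤ expect p g :=
  expect_mono_of_support fun a _ => h a

lemma expect_const (p : PMF α) (c : ℝ≥0∞) : expect p (fun _ => c) = c := by
  simp [expect, ENNReal.tsum_mul_right, p.tsum_coe]

lemma expect_add (p : PMF α) (f g : α → ℝ≥0∞) :
    expect p (fun a => f a + g a) = expect p f + expect p g := by
  simp [expect, mul_add, ENNReal.tsum_add]

lemma expect_mul_left (p : PMF α) (c : ℝ≥0∞) (f : α → ℝ≥0∞) :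
    expect p (fun a => c * f a) = c * expect p f := by
  simp only [expect, ← ENNReal.tsum_mul_left]
  exact tsum_congr fun a => by ring

lemma expect_pure (a : α) (f : α → ℝ≥0∞) : expect (PMF.pure a) f = f a := by
  rw [expect, tsum_eq_single a]
  · simp
  · intro b hb
    simp [hb]

lemma expect_bind (p : PMF α) (q : α → PMF β) (f : β → ℝ≥0∞) :
    expect (p.bind q) f = expect p fun a => expect (q a) f := by
  simp only [expect, PMF.bind_apply, ← ENNReal.tsum_mul_right, ← ENNReal.tsum_mul_left]
  rw [ENNReal.tsum_comm]
  exact tsum_congr fun a => tsum_congr fun b => by ring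

lemma expect_map (p : PMF α) (g : α → β) (f : β → ℝ≥0∞) :
    expect (p.map g) f = expect p fun a => f (g a) := by
  simp only [PMF.map, expect_bind, Function.comp, expect_pure]

lemma toOuterMeasure_eq_expect (p : PMF α) (s : Set α) :
    p.toOuterMeasure s = expect p (s.indicator 1) := by
  rw [PMF.toOuterMeasure_apply, expect]
  refine tsum_congr fun a => ?_
  by_cases h : a ∈ s <;> simp [h]

end Expectation

/-! ### Calculus for programs: sure properties and weighted expectations. -/

section Programs

variable {α : Type u} {β : Type v}

lemma Cost.samples_add (c d : Cost) : (c + d).samples = c.samples + d.samples := rfl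
lemma Cost.steps_add (c d : Cost) : (c + d).steps = c.steps + d.steps := rfl
lemma Cost.samples_zero : (0 : Cost).samples = 0 := rfl
lemma Cost.steps_zero : (0 : Cost).steps = 0 := rfl

lemma expect_andThen (x : Prog α) (g : α → Prog β) (f : β × Cost → ℝ≥0∞) :
    expect (andThen x g) f
      = expect x fun r => expect (g r.1) fun t => f (t.1, r.2 + t.2) := by
  simp only [andThen, expect_bind, expect_map]

lemma expect_prim (p : PMF α) (c : Cost) (f : α × Cost → ℝ≥0∞) :
    expect (prim p c) f = expect p fun a => f (a, c) := by
  simp only [prim, expect_map]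

/-- Every outcome of positive probability has the property `Q`. -/
def Ensures (x : Prog α) (Q : α → Cost → Prop) : Prop :=
  ∀ a c, x (a, c) ≠ 0 → Q a c

lemma Ensures.mono {x : Prog α} {Q R : α → Cost → Prop} (h : Ensures x Q)
    (hQR : ∀ a c, Q a c → R a c) : Ensures x R :=
  fun a c hac => hQR a c (h a c hac)

lemma ensures_prim {p : PMF α} {c : Cost} {Q : α → Cost → Prop}
    (h : ∀ a, p a ≠ 0 → Q a c) : Ensures (prim p c) Q := by
  intro a d had
  rw [prim, ← PMF.mem_support_iff, PMF.mem_support_map_iff] at had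
  obtain ⟨b, hb, he⟩ := had
  simp only [Prod.mk.injEq] at he
  obtain ⟨rfl, rfl⟩ := he
  exact h b hb

lemma ensures_pure {a : α} {c : Cost} {Q : α → Cost → Prop} (h : Q a c) :
    Ensures (PMF.pure (a, c)) Q := by
  intro b d hbd
  rw [← PMF.mem_support_iff, PMF.mem_support_pure_iff] at hbd
  simp only [Prod.mk.injEq] at hbd
  obtain ⟨rfl, rfl⟩ := hbd
  exact h

lemma ensures_ret {a : α} {Q : α → Cost → Prop} (h : Q a 0) : Ensures (ret a) Q :=
  ensures_pure h

lemma ensures_compute {a : α} {Q : α → Cost → Prop} (h : Q a ⟨0, 1⟩) :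
    Ensures (compute a) Q := by
  refine ensures_prim fun b hb => ?_
  rw [← PMF.mem_support_iff, PMF.mem_support_pure_iff] at hb
  exact hb ▸ h

lemma ensures_andThen {x : Prog α} {g : α → Prog β} {Q : α → Cost → Prop}
    {R : β → Cost → Prop} (hx : Ensures x Q)
    (hg : ∀ a c, Q a c → Ensures (g a) fun b d => R b (c + d)) : Ensures (andThen x g) R := by
  intro b e hbe
  rw [andThen, ← PMF.mem_support_iff, PMF.mem_support_bind_iff] at hbe
  obtain ⟨⟨a, c⟩, hac, hb⟩ := hbe
  rw [PMF.mem_support_map_iff] at hb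
  obtain ⟨⟨b', d⟩, hbd, he⟩ := hb
  simp only [Prod.mk.injEq] at he
  obtain ⟨rfl, rfl⟩ := he
  exact hg a c (hx a c hac) b' d hbd

lemma pure_andThen (a : α) (c : Cost) (g : α → Prog β) :
    andThen (PMF.pure (a, c)) g = (g a).map fun t => (t.1, c + t.2) := by
  simp [andThen, PMF.pure_bind]

lemma prim_pure (a : α) (c : Cost) : prim (PMF.pure a) c = PMF.pure (a, c) := by
  simp [prim, PMF.pure_map]

/-- The expectation of `φ` of the result plus `w` times the number of samples. -/
def val (φ : α → ℝ≥0∞) (w : ℝ≥0∞) (x : Prog α) : ℝ≥0∞ :=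
  expect x fun r => φ r.1 + w * r.2.samples

variable {φ : β → ℝ≥0∞} {w : ℝ≥0∞}

lemma val_pure (b : β) (c : Cost) : val φ w (PMF.pure (b, c)) = φ b + w * c.samples := by
  simp [val, expect_pure]

lemma val_ret (b : β) : val φ w (ret b) = φ b := by
  simp [ret, val_pure, Cost.samples_zero]

lemma val_andThen (x : Prog α) (g : α → Prog β) :
    val φ w (andThen x g) = expect x fun r => w * r.2.samples + val φ w (g r.1) := by
  rw [val, expect_andThen]
  congr 1
  funext r
  have h := expect_add (g r.1) (fun _ => w * r.2.samples) fun t => φ t.1 + w * t.2.samples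
  rw [expect_const] at h
  rw [val, ← h]
  congr 1
  funext t
  rw [Cost.samples_add]
  push_cast
  ring

lemma val_andThen_prim (p : PMF α) (c : Cost) (g : α → Prog β) :
    val φ w (andThen (prim p c) g) = w * c.samples + expect p fun a => val φ w (g a) := by
  have h := expect_add p (fun _ => w * c.samples) fun a => val φ w (g a)
  rw [expect_const] at h
  rw [val_andThen, expect_prim, ← h]

lemma val_andThen_pure (a : α) (c : Cost) (g : α → Prog β) :
    val φ w (andThen (PMF.pure (a, c)) g) = w * c.samples + val φ w (g a) := by
  rw [val_andThen, expect_pure]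

lemma val_andThen_compute (a : α) (g : α → Prog β) :
    val φ w (andThen (compute a) g) = val φ w (g a) := by
  simp [compute, prim_pure, val_andThen_pure]

end Programs

/-! ### Comparison of a computation with one that aborts more often. -/

section Domination

variable {α : Type u} {β : Type v}

/-- Every outcome with a result is at least as likely under `y` as under `x`. -/
def Dominated (x y : Prog (Option α)) : Prop :=
  ∀ f : Option α × Cost → ℝ≥0∞, (∀ c, f (none, c) = 0) → expect x f ≤ expect y f

lemma Dominated.refl (x : Prog (Option α)) : Dominated x x := fun _ _ => le_rfl

lemma dominated_ret_none (y : Prog (Option α)) : Dominated (ret none) y := by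
  intro f hf
  simp [ret, expect_pure, hf]

lemma dominated_andThen {x : Prog β} {g h : β → Prog (Option α)}
    (H : ∀ b, Dominated (g b) (h b)) : Dominated (andThen x g) (andThen x h) := by
  intro f hf
  rw [expect_andThen, expect_andThen]
  exact expect_mono fun r => H r.1 _ fun c => hf _

/-- Since `g` propagates `none`, the test function pulled back through `g` again vanishes on `none`;
this is what lets `hxy` be applied to the first stage. -/
lemma dominated_andThen_option {x y : Prog (Option β)} {g : Option β → Prog (Option α)}
    {h : Option β → Prog (Option α)} (hxy : Dominated x y) (hg : g none = ret none)
    (H : ∀ b, Dominated (g b) (h b)) : Dominated (andThen x g) (andThen y h) := by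
  intro f hf
  rw [expect_andThen, expect_andThen]
  refine (hxy _ fun c => ?_).trans (expect_mono fun r => H r.1 _ fun c => hf _)
  simp [hg, ret, expect_pure, hf]

end Domination

/-! ### Results and costs of the elementary table routines. -/

section Subroutines

variable {S : Type u}

-- The scan is deterministic, hence a point mass. Three steps per state: two lookups and at most one
-- insertion.
open Classical in
lemma newStates_eq (F : Finset S) (τ : List S) (N : Finset S) :
    ∃ c : Cost, newStates F τ N = PMF.pure (N ∪ (τ.toFinset \ F), c) ∧
      c.samples = 0 ∧ c.steps ≤ 3 * τ.length := by
  induction τ generalizing N with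
  | nil => exact ⟨0, by simp [newStates, ret], rfl, by simp [Cost.steps_zero]⟩
  | cons s τ ih =>
    simp only [newStates, tableLookup, tableInsert, prim_pure, pure_andThen]
    by_cases h : s ∈ F ∨ s ∈ N
    · obtain ⟨c, hc, h0, h1⟩ := ih N
      refine ⟨⟨0, 1⟩ + (⟨0, 1⟩ + c), ?_, by simp [Cost.samples_add, h0], ?_⟩
      · have hb : (decide (s ∈ F) || decide (s ∈ N)) = true := by simpa using h
        rw [if_pos hb, hc]
        simp only [PMF.pure_map]
        congr 2
        ext x
        simp only [List.toFinset_cons, Finset.mem_union, Finset.mem_sdiff, Finset.mem_insert]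
        constructor
        · tauto
        · rintro (hx | ⟨rfl | hx, hF⟩) <;> tauto
      · simp only [Cost.steps_add, List.length_cons]
        omega
    · obtain ⟨c, hc, h0, h1⟩ := ih (insert s N)
      refine ⟨⟨0, 1⟩ + (⟨0, 1⟩ + (⟨0, 1⟩ + c)), ?_, by simp [Cost.samples_add, h0], ?_⟩
      · have hb : ¬ (decide (s ∈ F) || decide (s ∈ N)) = true := by simpa using h
        rw [if_neg hb, hc]
        simp only [PMF.pure_map]
        congr 2
        ext x
        simp only [List.toFinset_cons, Finset.mem_union, Finset.mem_sdiff, Finset.mem_insert]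
        constructor
        · rintro ((rfl | hx) | hx) <;> tauto
        · rintro (hx | ⟨rfl | hx, hF⟩) <;> tauto
      · simp only [Cost.steps_add, List.length_cons]
        omega

open Classical in
lemma addStates_eq (τ : List S) (F : Finset S) :
    ∃ c : Cost, addStates τ F = PMF.pure (F ∪ τ.toFinset, c) ∧
      c.samples = 0 ∧ c.steps ≤ τ.length := by
  induction τ generalizing F with
  | nil => exact ⟨0, by simp [addStates, ret], rfl, by simp [Cost.steps_zero]⟩
  | cons s τ ih =>
    obtain ⟨c, hc, h0, h1⟩ := ih (insert s F)
    refine ⟨⟨0, 1⟩ + c, ?_, by simp [Cost.samples_add, h0], ?_⟩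
    · simp only [addStates, tableInsert, prim_pure, pure_andThen, hc, PMF.pure_map]
      congr 2
      ext x
      simp
    · simp only [Cost.steps_add, List.length_cons]
      omega

lemma escapes_eq (F : Finset S) (τ : List S) :
    ∃ (b : Bool) (c : Cost), escapes F τ = PMF.pure (b, c) ∧ (b = true ↔ ¬ ∀ s ∈ τ, s ∈ F) ∧
      c.samples = 0 ∧ c.steps ≤ τ.length := by
  induction τ with
  | nil => exact ⟨false, 0, by simp [escapes, ret], by simp, rfl, by simp [Cost.steps_zero]⟩
  | cons s τ ih =>
    simp only [escapes, tableLookup, prim_pure, pure_andThen]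
    by_cases h : s ∈ F
    · obtain ⟨b, c, hc, hb, h0, h1⟩ := ih
      refine ⟨b, ⟨0, 1⟩ + c, by simp [h, hc, PMF.pure_map], by simpa [h] using hb,
        by simp [Cost.samples_add, h0], ?_⟩
      simp only [Cost.steps_add, List.length_cons]
      omega
    · refine ⟨true, ⟨0, 1⟩ + 0, by simp [h, ret, PMF.pure_map], by simp [h], rfl, ?_⟩
      simp only [Cost.steps_add, Cost.steps_zero, List.length_cons]
      omega

lemma expect_coin {k : ℕ} (f : Bool × Cost → ℝ≥0∞) :
    expect (coin k) f
      = ((k : ℝ≥0)⁻¹ : ℝ≥0) * f (true, ⟨0, 1⟩) + (1 - (k : ℝ≥0)⁻¹ : ℝ≥0) * f (false, ⟨0, 1⟩) := by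
  rw [coin, expect_prim, expect, tsum_fintype, Fintype.sum_bool]
  rfl

lemma pathLaw_support (P : S → PMF S) (n : ℕ) (s : S) (τ : List S)
    (h : pathLaw P n s τ ≠ 0) : τ.length = n + 1 ∧ s ∈ τ := by
  induction n generalizing s τ with
  | zero =>
    rw [pathLaw, ← PMF.mem_support_iff, PMF.mem_support_pure_iff] at h
    simp [h]
  | succ n ih =>
    rw [pathLaw, ← PMF.mem_support_iff, PMF.mem_support_bind_iff] at h
    obtain ⟨s', -, h⟩ := h
    rw [PMF.mem_support_map_iff] at h
    obtain ⟨σ, hσ, rfl⟩ := h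
    simp [(ih s' σ hσ).1]

lemma trajLaw_support (M : MarkovModel S) {τ : List S} (h : M.trajLaw τ ≠ 0) :
    τ.length = M.H + 1 ∧ M.s₀ ∈ τ :=
  pathLaw_support _ _ _ _ h

end Subroutines

/-! ### Hoeffding's inequality for the estimation subroutine. -/

section Estimation

variable {S : Type u}

open Classical in
/-- The indicator of the event that the trajectory leaves `F`. -/
def escapeInd (F : Set S) (τ : List S) : ℝ≥0∞ := if ∀ s ∈ τ, s ∈ F then 0 else 1

lemma escapeInd_of_subset {F : Set S} {τ : List S} (h : ∀ s ∈ τ, s ∈ F) : escapeInd F τ = 0 :=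
  if_pos h

lemma escapeInd_of_not_subset {F : Set S} {τ : List S} (h : ¬ ∀ s ∈ τ, s ∈ F) :
    escapeInd F τ = 1 :=
  if_neg h

lemma escapeInd_le_one (F : Set S) (τ : List S) : escapeInd F τ ≤ 1 := by
  rw [escapeInd]
  split_ifs
  exacts [zero_le, le_rfl]

lemma ofReal_escapeProb (M : MarkovModel S) (F : Set S) :
    ENNReal.ofReal (escapeProb M F) = expect M.trajLaw (escapeInd F) := by
  have hle : M.trajLaw.toOuterMeasure {τ | ¬ ∀ s ∈ τ, s ∈ F}
      = expect M.trajLaw (escapeInd F) := by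
    rw [toOuterMeasure_eq_expect]
    congr 1
    funext τ
    by_cases h : ∀ s ∈ τ, s ∈ F
    · rw [escapeInd_of_subset h, Set.indicator_of_notMem]
      simpa using h
    · rw [escapeInd_of_not_subset h, Set.indicator_of_mem]
      · rfl
      · exact h
  rw [escapeProb, hle, ENNReal.ofReal_toReal]
  refine ne_top_of_le_ne_top ENNReal.one_ne_top ?_
  rw [← expect_const M.trajLaw 1]
  exact expect_mono (escapeInd_le_one F)

lemma escapeProb_nonneg (M : MarkovModel S) (F : Set S) : 0 ≤ escapeProb M F :=
  ENNReal.toReal_nonneg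

lemma escapeProb_le_one (M : MarkovModel S) (F : Set S) : escapeProb M F ≤ 1 := by
  have h : ENNReal.ofReal (escapeProb M F) ≤ ENNReal.ofReal 1 := by
    rw [ofReal_escapeProb, ENNReal.ofReal_one, ← expect_const M.trajLaw 1]
    exact expect_mono (escapeInd_le_one F)
  exact (ENNReal.ofReal_le_ofReal_iff zero_le_one).1 h

/-- Per trajectory: `H + 1` steps to observe it, at most `H + 1` lookups, and one update of the
counter. -/
lemma ensures_countEscapes (M : MarkovModel S) (F : Finset S) (n c : ℕ) :
    Ensures (countEscapes M F n c) fun _ d =>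
      d.samples = n ∧ d.steps ≤ (2 * M.H + 3) * n := by
  induction n generalizing c with
  | zero => exact ensures_ret (by simp [Cost.samples_zero, Cost.steps_zero])
  | succ n ih =>
    rw [countEscapes]
    refine ensures_andThen (Q := fun τ d => τ.length = M.H + 1 ∧ d = ⟨1, M.H + 1⟩)
      (ensures_prim fun τ hτ => ⟨(trajLaw_support M hτ).1, rfl⟩) ?_
    rintro τ - ⟨hτ, rfl⟩
    obtain ⟨b₀, e, he, -, he0, he1⟩ := escapes_eq F τ
    rw [he]
    refine ensures_andThen (Q := fun _ d => d = e) (ensures_pure rfl) ?_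
    intro b d hd
    rw [hd]
    refine ensures_andThen (Q := fun _ d => d = ⟨0, 1⟩) (ensures_compute rfl) ?_
    rintro c' - rfl
    refine (ih c').mono fun _ d hd => ?_
    simp only [Cost.samples_add, Cost.steps_add, he0, hd.1]
    refine ⟨by omega, ?_⟩
    have := hd.2
    rw [mul_add]
    omega

lemma ensures_estSafety (M : MarkovModel S) (ε l : ℝ) (F : Finset S) :
    Ensures (estSafety M ε l F) fun _ d =>
      d.samples = estSamples ε l ∧ d.steps ≤ (2 * M.H + 3) * estSamples ε l + 2 := by
  refine ensures_andThen (Q := fun n d => n = estSamples ε l ∧ d = ⟨0, 1⟩)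
    (ensures_compute ⟨rfl, rfl⟩) ?_
  rintro n - ⟨rfl, rfl⟩
  refine ensures_andThen (ensures_countEscapes M F _ 0) ?_
  rintro c d ⟨h1, h2⟩
  refine ensures_compute ?_
  simp only [Cost.samples_add, Cost.steps_add]
  omega

/-- Hoeffding's lemma for a Bernoulli variable. -/
lemma bernoulli_mgf_le {p : ℝ} (h0 : 0 ≤ p) (h1 : p ≤ 1) (s : ℝ) :
    (1 - p + p * Real.exp s) ≤ Real.exp (s * p + s ^ 2 / 8) := by
  have hq : ENNReal.ofReal p ≤ 1 := by simpa using h1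
  -- The Bernoulli law is realized on `Bool`, so that the sub-Gaussian bound for variables with
  -- values in `[0, 1]` applies; multiplying by `exp (s p)` removes the centering.
  let q : PMF Bool := PMF.ofFintype (fun b => cond b (ENNReal.ofReal p) (1 - ENNReal.ofReal p))
    (by simp [add_tsub_cancel_of_le hq])
  let X : Bool → ℝ := fun b => cond b 1 0
  have hsub : (1 - ENNReal.ofReal p).toReal = 1 - p := by
    rw [ENNReal.toReal_sub_of_le hq ENNReal.one_ne_top, ENNReal.toReal_ofReal h0,
      ENNReal.toReal_one]
  have hint : ∀ f : Bool → ℝ, ∫ b, f b ∂q.toMeasure = p * f true + (1 - p) * f false := by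
    intro f
    rw [PMF.integral_eq_sum, Fintype.sum_bool]
    simp [q, PMF.ofFintype_apply, hsub, ENNReal.toReal_ofReal h0]
  have h := (ProbabilityTheory.hasSubgaussianMGF_of_mem_Icc (μ := q.toMeasure) (X := X)
    (a := 0) (b := 1) (measurable_of_finite X).aemeasurable
    (Filter.Eventually.of_forall fun b => by cases b <;> simp [X])).mgf_le s
  rw [ProbabilityTheory.mgf, hint, hint] at h
  simp only [X, cond_true, cond_false] at h
  have e1 : Real.exp (s * p + s ^ 2 / 8) = Real.exp (s * p) * Real.exp (s ^ 2 / 8) :=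
    Real.exp_add _ _
  have e2 : Real.exp (s * (1 - (p * 1 + (1 - p) * 0))) = Real.exp s * (Real.exp (s * p))⁻¹ := by
    rw [← Real.exp_neg, ← Real.exp_add]
    congr 1
    ring
  have e3 : Real.exp (s * (0 - (p * 1 + (1 - p) * 0))) = (Real.exp (s * p))⁻¹ := by
    rw [← Real.exp_neg]
    congr 1
    ring
  rw [e2, e3] at h
  have e4 : ((((‖(1 : ℝ) - 0‖₊ / 2) ^ 2 : ℝ≥0) : ℝ) * s ^ 2 / 2) = s ^ 2 / 8 := by
    simp
    ring
  rw [e4] at h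
  have hp := Real.exp_pos (s * p)
  rw [e1]
  calc 1 - p + p * Real.exp s
      = Real.exp (s * p) * (p * (Real.exp s * (Real.exp (s * p))⁻¹)
          + (1 - p) * (Real.exp (s * p))⁻¹) := by
        field_simp
        ring
    _ ≤ _ := by gcongr

/-- Each fresh trajectory multiplies the exponential moment by the moment generating function of a
Bernoulli variable, so independence enters only through the recursion of the program. -/
lemma expect_exp_countEscapes_le (M : MarkovModel S) (F : Finset S) (s : ℝ) (n c : ℕ) :
    expect (countEscapes M F n c) (fun r => ENNReal.ofReal (Real.exp (s * r.1)))
      ≤ ENNReal.ofReal (Real.exp (s * c + n * (s * escapeProb M F + s ^ 2 / 8))) := by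
  set p := escapeProb M (F : Set S) with hp
  induction n generalizing c with
  | zero => simp [countEscapes, ret, expect_pure]
  | succ n ih =>
    set t := s * p + s ^ 2 / 8 with ht
    rw [countEscapes, sampleTraj, expect_andThen, expect_prim]
    set A := ENNReal.ofReal (Real.exp (s * c + n * t)) with hA
    have hτ : ∀ τ : List S, expect (andThen (escapes F τ) fun e =>
        andThen (compute (if e then c + 1 else c)) fun c' => countEscapes M F n c')
          (fun t => ENNReal.ofReal (Real.exp (s * (t.1 : ℕ))))
        ≤ A * (1 - escapeInd F τ) + A * ENNReal.ofReal (Real.exp s) * escapeInd F τ := by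
      intro τ
      obtain ⟨b, e, he, hb, -, -⟩ := escapes_eq F τ
      rw [he, expect_andThen, expect_pure, compute, expect_andThen, prim_pure, expect_pure]
      refine (ih _).trans ?_
      by_cases h : ∀ x ∈ τ, x ∈ F
      · have h' : ∀ x ∈ τ, x ∈ (F : Set S) := by simpa using h
        have hd : b = false := Bool.eq_false_iff.2 fun hbt => hb.1 hbt h
        rw [escapeInd_of_subset h', hd]
        simp [hA]
      · have h' : ¬ ∀ x ∈ τ, x ∈ (F : Set S) := by simpa using h
        rw [escapeInd_of_not_subset h', hb.2 h]
        simp only [if_true, mul_one, tsub_self,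
          mul_zero, zero_add]
        rw [← ENNReal.ofReal_mul (Real.exp_nonneg _), ← Real.exp_add]
        refine ENNReal.ofReal_le_ofReal (Real.exp_le_exp.2 ?_)
        push_cast
        linarith
    have hp0 : 0 ≤ p := escapeProb_nonneg M F
    have hp1 : p ≤ 1 := escapeProb_le_one M F
    have hin : expect M.trajLaw (fun τ => 1 - escapeInd F τ) = ENNReal.ofReal (1 - p) := by
      have h := expect_add M.trajLaw (fun τ => 1 - escapeInd F τ) (escapeInd F)
      rw [← ofReal_escapeProb, ← hp] at h
      simp only [tsub_add_cancel_of_le (escapeInd_le_one _ _), expect_const] at h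
      rw [ENNReal.ofReal_sub _ hp0, ENNReal.ofReal_one]
      exact ENNReal.eq_sub_of_add_eq ENNReal.ofReal_ne_top h.symm
    refine (expect_mono hτ).trans ?_
    rw [expect_add, expect_mul_left, expect_mul_left, hin, ← ofReal_escapeProb, ← hp, mul_assoc,
      ← mul_add, ← ENNReal.ofReal_mul (Real.exp_nonneg _),
      ← ENNReal.ofReal_add (by linarith) (by positivity), hA,
      ← ENNReal.ofReal_mul (Real.exp_nonneg _)]
    refine ENNReal.ofReal_le_ofReal ?_
    have hb := bernoulli_mgf_le hp0 hp1 s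
    rw [← ht] at hb
    calc Real.exp (s * c + n * t) * (1 - p + Real.exp s * p)
        = Real.exp (s * c + n * t) * (1 - p + p * Real.exp s) := by ring
      _ ≤ Real.exp (s * c + n * t) * Real.exp t := by gcongr
      _ = _ := by
        rw [← Real.exp_add]
        congr 1
        push_cast
        ring

/-- Hoeffding's inequality for the number of escapes. -/
lemma expect_countEscapes_deviation_le (M : MarkovModel S) (F : Finset S) {ε : ℝ} (hε : 0 < ε)
    (n : ℕ) :
    expect (countEscapes M F n 0)
        (fun r => if n * ε < |(r.1 : ℝ) - n * escapeProb M F| then 1 else 0)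
      ≤ ENNReal.ofReal (2 * Real.exp (-(2 * n * ε ^ 2))) := by
  set p := escapeProb M (F : Set S) with hp
  -- Chernoff's method with the optimal parameters `s = ±4ε`: the exponent is `n s²/8 - 4nε² =
  -- -2nε²`.
  set e := ENNReal.ofReal (Real.exp (-(n * (4 * ε * p + 4 * ε ^ 2)))) with he
  set e' := ENNReal.ofReal (Real.exp (n * (4 * ε * p - 4 * ε ^ 2))) with he'
  have key : ∀ r : ℕ × Cost, (if n * ε < |(r.1 : ℝ) - n * p| then (1 : ℝ≥0∞) else 0)
      ≤ e * ENNReal.ofReal (Real.exp (4 * ε * r.1))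
        + e' * ENNReal.ofReal (Real.exp (-(4 * ε) * r.1)) := by
    intro r
    split_ifs with h
    swap
    · exact zero_le
    rw [he, he', ← ENNReal.ofReal_mul (Real.exp_nonneg _), ← ENNReal.ofReal_mul (Real.exp_nonneg _),
      ← Real.exp_add, ← Real.exp_add]
    rcases lt_abs.1 h with h | h
    · refine le_add_right (ENNReal.one_le_ofReal.2 (Real.one_le_exp ?_))
      nlinarith
    · refine le_add_left (ENNReal.one_le_ofReal.2 (Real.one_le_exp ?_))
      nlinarith
  refine (expect_mono key).trans ?_
  rw [expect_add, expect_mul_left, expect_mul_left, two_mul,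
    ENNReal.ofReal_add (Real.exp_nonneg _) (Real.exp_nonneg _)]
  gcongr
  · refine (mul_le_mul_right (expect_exp_countEscapes_le M F (4 * ε) n 0) e).trans ?_
    rw [he, ← ENNReal.ofReal_mul (Real.exp_nonneg _), ← Real.exp_add, ← hp]
    refine ENNReal.ofReal_le_ofReal (Real.exp_le_exp.2 (le_of_eq ?_))
    push_cast
    ring
  · refine (mul_le_mul_right (expect_exp_countEscapes_le M F (-(4 * ε)) n 0) e').trans ?_
    rw [he', ← ENNReal.ofReal_mul (Real.exp_nonneg _), ← Real.exp_add, ← hp]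
    refine ENNReal.ofReal_le_ofReal (Real.exp_le_exp.2 (le_of_eq ?_))
    push_cast
    ring

lemma two_mul_exp_estSamples_le {ε l : ℝ} (hε : 0 < ε) (hl : 0 < l) :
    2 * Real.exp (-(2 * estSamples ε l * ε ^ 2)) ≤ l := by
  have h : 1 / (2 * ε ^ 2) * Real.log (2 / l) ≤ estSamples ε l := Nat.le_ceil _
  have h2 : Real.log (2 / l) ≤ 2 * estSamples ε l * ε ^ 2 := by
    calc Real.log (2 / l) = 1 / (2 * ε ^ 2) * Real.log (2 / l) * (2 * ε ^ 2) := by field_simp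
      _ ≤ estSamples ε l * (2 * ε ^ 2) := by gcongr
      _ = _ := by ring
  calc 2 * Real.exp (-(2 * estSamples ε l * ε ^ 2)) ≤ 2 * Real.exp (-Real.log (2 / l)) := by
        gcongr
    _ = l := by
        rw [Real.exp_neg, Real.exp_log (by positivity)]
        field_simp

/-- The estimate misses the escape probability by more than `ε` with probability at most `l`. -/
lemma expect_estSafety_deviation_le (M : MarkovModel S) (F : Finset S) {ε l : ℝ} (hε : 0 < ε)
    (hl : 0 < l) :
    expect (estSafety M ε l F) (fun r => if |r.1 - escapeProb M F| ≤ ε then 0 else 1)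
      ≤ ENNReal.ofReal l := by
  refine le_trans ?_ (ENNReal.ofReal_le_ofReal (two_mul_exp_estSamples_le hε hl))
  set n := estSamples ε l with hn
  rcases Nat.eq_zero_or_pos n with h0 | h0
  -- Without samples the estimate is the junk value `0 / 0`, but then the claimed bound is `2`.
  · rw [h0]
    refine le_trans (b := 1) ?_ (by simp)
    refine (expect_mono (g := fun _ => 1) fun r => ?_).trans_eq (expect_const _ 1)
    split_ifs
    exacts [zero_le_one, le_rfl]
  · refine le_trans (le_of_eq ?_) (expect_countEscapes_deviation_le M F hε n)
    rw [estSafety, compute, expect_andThen, prim_pure, expect_pure, expect_andThen]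
    congr 1
    funext r
    rw [compute, prim_pure, expect_pure]
    have hn0 : (0 : ℝ) < n := by exact_mod_cast h0
    have : (|(r.1 : ℝ) / (n : ℝ) - escapeProb M F| ≤ ε) ↔
        ¬ n * ε < |(r.1 : ℝ) - n * escapeProb M F| := by
      rw [not_lt]
      have e : (r.1 : ℝ) - n * escapeProb M F = n * ((r.1 : ℝ) / n - escapeProb M F) := by
        field_simp
      rw [e, abs_mul, abs_of_pos hn0, mul_le_mul_iff_right₀ hn0]
    simp only [← hn, this]
    split_ifs <;> rfl

end Estimation

/-! ### Expected progress of one iteration towards a safe set. -/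

section Potential

variable {S : Type u}

open Classical in
/-- The states of `τ` outside `F`. -/
def freshStates (F : Finset S) (τ : List S) : Finset S := τ.toFinset \ F

/-- The probability with which the algorithm accepts the trajectory `τ`. -/
def acceptProb (F : Finset S) (τ : List S) : ℝ≥0 := ((freshStates F τ).card : ℝ≥0)⁻¹

open Classical in
/-- The number of states of `G` that are missing from `F`. -/
def missing (G F : Finset S) : ℕ := (G \ F).card

open Classical in
lemma missing_union_add (G F : Finset S) (τ : List S) :
    missing G (F ∪ τ.toFinset) + (G ∩ freshStates F τ).card = missing G F := by
  rw [missing, missing, ← Finset.card_union_of_disjoint]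
  · congr 1
    ext x
    simp only [freshStates, Finset.mem_union, Finset.mem_sdiff, Finset.mem_inter]
    tauto
  · rw [Finset.disjoint_left]
    intro x
    simp only [freshStates, Finset.mem_union, Finset.mem_sdiff, Finset.mem_inter]
    tauto

lemma freshStates_card_eq_zero {F : Finset S} {τ : List S} :
    (freshStates F τ).card = 0 ↔ ∀ s ∈ τ, s ∈ (F : Set S) := by
  simp [freshStates, Finset.subset_iff]

lemma acceptProb_le_one (F : Finset S) (τ : List S) : acceptProb F τ ≤ 1 :=
  Nat.cast_inv_le_one _

/-- The purpose of accepting with probability `1/n`: long and short escaping trajectories contribute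
equally. When `n = 0`, the convention `0⁻¹ = 0` fits too. -/
lemma acceptProb_mul_card (F : Finset S) (τ : List S) :
    (acceptProb F τ : ℝ≥0∞) * (freshStates F τ).card = escapeInd (F : Set S) τ := by
  by_cases h : (freshStates F τ).card = 0
  · rw [escapeInd_of_subset (freshStates_card_eq_zero.1 h), h]
    simp
  · rw [escapeInd_of_not_subset (fun h' => h (freshStates_card_eq_zero.2 h')), acceptProb]
    have h0 : ((freshStates F τ).card : ℝ≥0) ≠ 0 := by exact_mod_cast h
    have : (((((freshStates F τ).card : ℝ≥0)⁻¹ * (freshStates F τ).card : ℝ≥0)) : ℝ≥0∞) = 1 := by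
      rw [inv_mul_cancel₀ h0, ENNReal.coe_one]
    simpa using this

lemma acceptProb_le_escapeInd (F : Finset S) (τ : List S) :
    (acceptProb F τ : ℝ≥0∞) ≤ escapeInd (F : Set S) τ := by
  rw [← acceptProb_mul_card]
  by_cases h : (freshStates F τ).card = 0
  · simp [acceptProb, h]
  · have : (1 : ℝ≥0∞) ≤ (freshStates F τ).card := by
      exact_mod_cast Nat.one_le_iff_ne_zero.2 h
    calc (acceptProb F τ : ℝ≥0∞) = acceptProb F τ * 1 := (mul_one _).symm
      _ ≤ _ := by gcongr

open Classical in
/-- A trajectory inside `G` that leaves `F` brings, once accepted, only states of `G`. -/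
lemma escapeInd_le (G F : Finset S) (τ : List S) :
    escapeInd (F : Set S) τ
      ≤ escapeInd (G : Set S) τ + acceptProb F τ * (G ∩ freshStates F τ).card := by
  by_cases h : ∀ s ∈ τ, s ∈ (G : Set S)
  · have : G ∩ freshStates F τ = freshStates F τ := by
      rw [Finset.inter_eq_right]
      intro x hx
      simp only [freshStates, Finset.mem_sdiff, List.mem_toFinset] at hx
      exact h x hx.1
    rw [this, acceptProb_mul_card]
    exact le_add_self
  · rw [escapeInd_of_not_subset h]
    exact (escapeInd_le_one _ _).trans le_self_add

open Classical in
/-- The expected number of states of a safe set that one iteration finds. -/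
lemma expected_gain (M : MarkovModel S) {ρ : ℝ} {G F : Finset S} (hρ : 0 < ρ)
    (hG : IsSafe M ρ (G : Set S)) (hF : 2 * ρ ≤ escapeProb M F) :
    ENNReal.ofReal ρ
        ≤ expect M.trajLaw (fun τ => (acceptProb F τ : ℝ≥0∞) * (G ∩ freshStates F τ).card) ∧
      ENNReal.ofReal (escapeProb M F)
        ≤ 2 * expect M.trajLaw (fun τ => (acceptProb F τ : ℝ≥0∞) * (G ∩ freshStates F τ).card) := by
  set A := expect M.trajLaw (fun τ => (acceptProb F τ : ℝ≥0∞) * (G ∩ freshStates F τ).card)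
    with hA
  have h1 : ENNReal.ofReal (escapeProb M F) ≤ ENNReal.ofReal ρ + A := by
    calc ENNReal.ofReal (escapeProb M F) = expect M.trajLaw (escapeInd F) :=
          ofReal_escapeProb M F
      _ ≤ expect M.trajLaw (fun τ => escapeInd (G : Set S) τ
            + (acceptProb F τ : ℝ≥0∞) * (G ∩ freshStates F τ).card) := expect_mono (escapeInd_le G F)
      _ = ENNReal.ofReal (escapeProb M G) + A := by rw [expect_add, ← ofReal_escapeProb]
      _ ≤ ENNReal.ofReal ρ + A := by
          gcongr
          exact hG
  -- From `2ρ ≤ Δ(F) ≤ ρ + A`; then `ρ ≤ A` also turns `h1` into `Δ(F) ≤ 2A`.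
  have h2 : ENNReal.ofReal ρ ≤ A := by
    have : ENNReal.ofReal ρ + ENNReal.ofReal ρ ≤ ENNReal.ofReal ρ + A := by
      refine le_trans ?_ h1
      rw [← ENNReal.ofReal_add hρ.le hρ.le, ← two_mul]
      exact ENNReal.ofReal_le_ofReal hF
    exact (ENNReal.add_le_add_iff_left ENNReal.ofReal_ne_top).1 this
  refine ⟨h2, h1.trans ?_⟩
  rw [two_mul]
  gcongr

open Classical in
/-- One iteration decreases a potential that is linear in the number of missing safe states. -/
lemma expect_iteration_le (M : MarkovModel S) {ρ : ℝ} {G F : Finset S} (hρ : 0 < ρ)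
    (hG : IsSafe M ρ (G : Set S)) (hF : 2 * ρ ≤ escapeProb M F) {σ κ γ : ℝ≥0∞} (β : ℝ≥0∞)
    (hκ : κ ≠ ∞) (hγ : γ ≠ ∞) {a : ℝ≥0∞} (ha : a = σ / ENNReal.ofReal ρ + 2 * (κ + γ)) :
    expect M.trajLaw (fun τ =>
        (acceptProb F τ : ℝ≥0∞) *
          (a * missing G (F ∪ τ.toFinset) + β + κ + γ * (freshStates F τ).card)
          + ((1 - acceptProb F τ : ℝ≥0) : ℝ≥0∞) * (a * missing G F + β)) + σ
      ≤ a * missing G F + β := by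
  obtain ⟨h1, h2⟩ := expected_gain M hρ hG hF
  set A := expect M.trajLaw (fun τ => (acceptProb F τ : ℝ≥0∞) * (G ∩ freshStates F τ).card)
    with hA
  set D := ENNReal.ofReal (escapeProb M F) with hD
  set X := expect M.trajLaw (fun τ =>
        (acceptProb F τ : ℝ≥0∞) *
          (a * missing G (F ∪ τ.toFinset) + β + κ + γ * (freshStates F τ).card)
          + ((1 - acceptProb F τ : ℝ≥0) : ℝ≥0∞) * (a * missing G F + β)) with hX
  -- Balance of one iteration: `a * A` is the expected drop of the potential, while an acceptance
  -- (probability at most `D`) costs `κ` and the new states (`D` on average) cost `γ` each.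
  have hsum : X + a * A ≤ a * missing G F + β + (κ + γ) * D := by
    rw [hX, hA, ← expect_mul_left, ← expect_add, hD, ofReal_escapeProb, ← expect_mul_left]
    refine le_trans (expect_mono (g := fun τ => a * missing G F + β
      + (κ + γ) * escapeInd (F : Set S) τ) fun τ => ?_) ?_
    · have hq : (acceptProb F τ : ℝ≥0∞) + ((1 - acceptProb F τ : ℝ≥0) : ℝ≥0∞) = 1 := by
        rw [← ENNReal.coe_add, add_tsub_cancel_of_le (acceptProb_le_one F τ), ENNReal.coe_one]
      set q := (acceptProb F τ : ℝ≥0∞) with hqd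
      set q' := ((1 - acceptProb F τ : ℝ≥0) : ℝ≥0∞)
      have hm : (missing G F : ℝ≥0∞)
          = missing G (F ∪ τ.toFinset) + (G ∩ freshStates F τ).card := by
        exact_mod_cast (missing_union_add G F τ).symm
      calc q * (a * missing G (F ∪ τ.toFinset) + β + κ + γ * (freshStates F τ).card)
            + q' * (a * missing G F + β) + a * (q * (G ∩ freshStates F τ).card)
          = q * (a * (missing G (F ∪ τ.toFinset) + (G ∩ freshStates F τ).card) + β)
            + q' * (a * missing G F + β) + (κ * q + γ * (q * (freshStates F τ).card)) := by ring
        _ = (q + q') * (a * missing G F + β) + (κ * q + γ * (q * (freshStates F τ).card)) := by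
            rw [← hm]; ring
        _ ≤ a * missing G F + β + (κ + γ) * escapeInd (F : Set S) τ := by
            rw [hq, one_mul, hqd, acceptProb_mul_card, add_mul]
            gcongr
            exact acceptProb_le_escapeInd F τ
    · rw [expect_add, expect_const]
  have hρ0 : ENNReal.ofReal ρ ≠ 0 := by simpa using hρ
  -- The two summands of `a` are chosen for the two lower bounds on `A`: `A ≥ ρ` pays the fixed cost
  -- `σ`, and `2A ≥ D` pays for acceptance and growth.
  have hlow : σ + (κ + γ) * D ≤ a * A := by
    rw [ha, add_mul (σ / ENNReal.ofReal ρ)]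
    refine add_le_add ?_ ?_
    · calc σ = σ / ENNReal.ofReal ρ * ENNReal.ofReal ρ :=
            (ENNReal.div_mul_cancel hρ0 ENNReal.ofReal_ne_top).symm
        _ ≤ _ := by gcongr
    · calc (κ + γ) * D ≤ (κ + γ) * (2 * A) := by gcongr
        _ = 2 * (κ + γ) * A := by ring
  have hfin : (κ + γ) * D ≠ ∞ :=
    ENNReal.mul_ne_top (ENNReal.add_ne_top.2 ⟨hκ, hγ⟩) ENNReal.ofReal_ne_top
  refine (ENNReal.add_le_add_iff_right hfin).1 ?_
  calc X + σ + (κ + γ) * D = X + (σ + (κ + γ) * D) := by ring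
    _ ≤ X + a * A := by gcongr
    _ ≤ _ := hsum

end Potential

/-! ### The loop with guards: a lower approximation with sure guarantees. -/

section GuardedLoop

variable {S : Type u}

open Classical in
/-- The main loop, giving up after `K` accepted trajectories or an estimate that is off by more
than `ε`. -/
def guardedLoop (M : MarkovModel S) (ρ ε lam : ℝ) (K : ℕ) :
    (fuel : ℕ) → Finset S → ℕ → ℝ → Prog (Option (Finset S))
  | 0, _, _, _ => ret none
  | fuel + 1, F, j, d =>
      andThen (compute (decide (d > 2 * ρ + ε))) fun continues =>
      if continues then
        andThen (sampleTraj M) fun τ =>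
        andThen (newStates F τ ∅) fun N =>
        andThen (tableSize N) fun k =>
        andThen (compute (decide (k ≠ 0))) fun hasNew =>
        if hasNew then
          andThen (coin k) fun accept =>
          if accept then
            andThen (addStates τ F) fun F' =>
            andThen (compute (lamSeq lam j)) fun l =>
            andThen (compute (j + 1)) fun j' =>
            if j ≤ K then
              andThen (estSafety M ε l F') fun d' =>
              if |d' - escapeProb M F'| ≤ ε then guardedLoop M ρ ε lam K fuel F' j' d'
              else ret none
            else ret none
          else guardedLoop M ρ ε lam K fuel F j d
        else guardedLoop M ρ ε lam K fuel F j d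
      else ret (some F)

lemma dominated_ite_none {α : Type u} {c : Prop} [Decidable c] {x y : Prog (Option α)}
    (h : Dominated x y) : Dominated (if c then x else ret none) y := by
  split_ifs
  exacts [h, dominated_ret_none y]

lemma dominated_guardedLoop (M : MarkovModel S) (ρ ε lam : ℝ) (K fuel : ℕ) (F : Finset S)
    (j : ℕ) (d : ℝ) :
    Dominated (guardedLoop M ρ ε lam K fuel F j d) (mainLoop M ρ ε lam fuel F j d) := by
  induction fuel generalizing F j d with
  | zero => exact Dominated.refl _
  | succ fuel ih =>
    rw [guardedLoop, mainLoop]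
    refine dominated_andThen fun continues => ?_
    by_cases hc : continues = true
    swap
    · rw [if_neg hc, if_neg hc]
      exact Dominated.refl _
    rw [if_pos hc, if_pos hc]
    refine dominated_andThen fun τ => dominated_andThen fun N => dominated_andThen fun k =>
      dominated_andThen fun hasNew => ?_
    by_cases hn : hasNew = true
    swap
    · rw [if_neg hn, if_neg hn]
      exact ih _ _ _
    rw [if_pos hn, if_pos hn]
    refine dominated_andThen fun accept => ?_
    by_cases ha : accept = true
    swap
    · rw [if_neg ha, if_neg ha]
      exact ih _ _ _
    rw [if_pos ha, if_pos ha]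
    refine dominated_andThen fun F' => dominated_andThen fun l => dominated_andThen fun j' => ?_
    exact dominated_ite_none (dominated_andThen fun d' => dominated_ite_none (ih _ _ _))

/-- Besides the estimation, one iteration takes at most `5(H + 1)` steps for the trajectory and `8`
single steps, hence the factor `13`; each sample of an estimate costs only `2H + 3`. The final `1`
is the last test of the loop condition. Safety at exit is the invariant `hd`, which the guard on
estimates restores. -/
lemma ensures_guardedLoop (M : MarkovModel S) {ρ ε lam : ℝ} (K fuel : ℕ) (F : Finset S)
    (j : ℕ) (d : ℝ) (hd : d ≤ 2 * ρ + ε → escapeProb M F ≤ 2 * ρ + 2 * ε) :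
    Ensures (guardedLoop M ρ ε lam K fuel F j d) fun out c =>
      (∀ F', out = some F' → escapeProb M F' ≤ 2 * ρ + 2 * ε) ∧
        c.steps ≤ 13 * (M.H + 1) * c.samples + 1 := by
  induction fuel generalizing F j d with
  | zero => exact ensures_ret (by simp [Cost.steps_zero])
  | succ fuel ih =>
    rw [guardedLoop]
    refine ensures_andThen (Q := fun b c => b = decide (d > 2 * ρ + ε) ∧ c = ⟨0, 1⟩)
      (ensures_compute ⟨rfl, rfl⟩) ?_
    rintro continues - ⟨hc, rfl⟩
    by_cases hcont : continues = true
    swap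
    · rw [if_neg hcont]
      refine ensures_ret ⟨fun F' hF' => ?_, by simp [Cost.steps_add, Cost.steps_zero]⟩
      cases hF'
      refine hd ?_
      rw [hc] at hcont
      simpa using hcont
    rw [if_pos hcont]
    refine ensures_andThen (Q := fun τ d => τ.length = M.H + 1 ∧ d = ⟨1, M.H + 1⟩)
      (ensures_prim fun τ hτ => ⟨(trajLaw_support M hτ).1, rfl⟩) ?_
    rintro τ - ⟨hτ, rfl⟩
    obtain ⟨e, he, he0, he1⟩ := newStates_eq F τ ∅
    rw [he]
    refine ensures_andThen (Q := fun _ d => d = e) (ensures_pure rfl) ?_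
    intro N c hce
    rw [hce]
    clear hce he
    refine ensures_andThen (Q := fun _ d => d = ⟨0, 1⟩) (ensures_prim fun _ _ => rfl) ?_
    rintro k - rfl
    refine ensures_andThen (Q := fun _ d => d = ⟨0, 1⟩) (ensures_compute rfl) ?_
    rintro hasNew - rfl
    by_cases hnew : hasNew = true
    swap
    · rw [if_neg hnew]
      refine (ih F j d hd).mono fun out c hoc => ⟨hoc.1, ?_⟩
      have := hoc.2
      simp only [Cost.steps_add, Cost.samples_add, he0, add_mul, mul_add, mul_one,
        mul_assoc] at this ⊢
      omega
    rw [if_pos hnew]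
    refine ensures_andThen (Q := fun _ d => d = ⟨0, 1⟩) (ensures_prim fun _ _ => rfl) ?_
    rintro accept - rfl
    by_cases hacc : accept = true
    swap
    · rw [if_neg hacc]
      refine (ih F j d hd).mono fun out c hoc => ⟨hoc.1, ?_⟩
      have := hoc.2
      simp only [Cost.steps_add, Cost.samples_add, he0, add_mul, mul_add, mul_one,
        mul_assoc] at this ⊢
      omega
    rw [if_pos hacc]
    obtain ⟨e', he', he0', he1'⟩ := addStates_eq τ F
    rw [he']
    refine ensures_andThen (Q := fun _ d => d = e') (ensures_pure rfl) ?_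
    intro F' c hce
    rw [hce]
    clear hce he'
    refine ensures_andThen (Q := fun _ d => d = ⟨0, 1⟩) (ensures_compute rfl) ?_
    rintro l - rfl
    refine ensures_andThen (Q := fun _ d => d = ⟨0, 1⟩) (ensures_compute rfl) ?_
    rintro j' - rfl
    split_ifs
    swap
    · refine ensures_ret ⟨by simp, ?_⟩
      simp only [Cost.steps_add, Cost.samples_add, he0, he0', add_mul, mul_add, mul_one,
        mul_assoc, Cost.steps_zero, Cost.samples_zero]
      omega
    refine ensures_andThen (ensures_estSafety M ε l F') ?_
    rintro d' c₁ ⟨hs, ht⟩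
    have key : c₁.steps ≤ 2 * (M.H * c₁.samples) + 3 * c₁.samples + 2 := by
      rw [hs]
      refine ht.trans (le_of_eq ?_)
      ring
    split_ifs with hest
    · refine (ih F' j' d' fun h => ?_).mono fun out c hoc => ⟨hoc.1, ?_⟩
      · have := (abs_le.1 hest).1
        linarith
      · have := hoc.2
        simp only [Cost.steps_add, Cost.samples_add, he0, he0', add_mul, mul_add, mul_one,
          mul_assoc] at this ⊢
        omega
    · refine ensures_ret ⟨by simp, ?_⟩
      simp only [Cost.steps_add, Cost.samples_add, he0, he0', add_mul, mul_add, mul_one,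
        mul_assoc, Cost.steps_zero, Cost.samples_zero]
      omega

end GuardedLoop

/-! ### The potential argument for the whole loop. -/

section LoopBound

variable {S : Type u}

/-- A bound for `∑ i ≥ j, lamSeq lam i`. -/
def lamTail (lam : ℝ) (j : ℕ) : ℝ := 3 * lam / (2 * Real.pi ^ 2) / ((j : ℝ) - 1 / 2)

lemma lamSeq_pos {lam : ℝ} (hlam : 0 < lam) {j : ℕ} (hj : 1 ≤ j) : 0 < lamSeq lam j := by
  have : (0 : ℝ) < j := by exact_mod_cast hj
  have := Real.pi_pos
  unfold lamSeq
  positivity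

lemma lamTail_nonneg {lam : ℝ} (hlam : 0 < lam) {j : ℕ} (hj : 1 ≤ j) : 0 ≤ lamTail lam j := by
  have : (1 : ℝ) ≤ j := by exact_mod_cast hj
  have := Real.pi_pos
  exact div_nonneg (by positivity) (by linarith)

/-- Telescoping: `1/j² ≤ 1/(j² - 1/4) = 1/(j - 1/2) - 1/(j + 1/2)`. -/
lemma lamSeq_add_lamTail_le {lam : ℝ} (hlam : 0 < lam) {j : ℕ} (hj : 1 ≤ j) :
    lamSeq lam j + lamTail lam (j + 1) ≤ lamTail lam j := by
  have h1 : (1 : ℝ) ≤ j := by exact_mod_cast hj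
  have hpi := Real.pi_pos
  set c := 3 * lam / (2 * Real.pi ^ 2) with hc
  have hc0 : 0 ≤ c := by positivity
  have e1 : lamSeq lam j = c * (1 / (j : ℝ) ^ 2) := by
    rw [lamSeq, hc]
    field_simp
  have e2 : (1 : ℝ) / (j : ℝ) ^ 2 ≤ 1 / ((j : ℝ) - 1 / 2) - 1 / ((j : ℝ) + 1 / 2) := by
    rw [div_sub_div _ _ (by linarith) (by linarith),
      div_le_div_iff₀ (by positivity) (by nlinarith)]
    nlinarith
  have e3 : lamTail lam (j + 1) = c * (1 / ((j : ℝ) + 1 / 2)) := by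
    rw [lamTail, ← hc]
    push_cast
    rw [mul_one_div]
    congr 1
    ring
  have e4 : lamTail lam j = c * (1 / ((j : ℝ) - 1 / 2)) := by
    rw [lamTail, ← hc, mul_one_div]
  rw [e1, e3, e4]
  nlinarith [mul_le_mul_of_nonneg_left e2 hc0]

lemma lamTail_one_le {lam : ℝ} (hlam : 0 < lam) : lamTail lam 1 ≤ lam := by
  have hpi := Real.pi_gt_three
  rw [lamTail, Nat.cast_one, div_div, div_le_iff₀ (by positivity)]
  nlinarith [mul_pos hlam (sub_pos.2 hpi)]

lemma estSamples_lamSeq_mono {ε lam : ℝ} (hlam : 0 < lam) {j K : ℕ} (hj : 1 ≤ j)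
    (hjK : j ≤ K) : estSamples ε (lamSeq lam j) ≤ estSamples ε (lamSeq lam K) := by
  have hK := lamSeq_pos hlam (hj.trans hjK)
  have hle : lamSeq lam K ≤ lamSeq lam j := by
    have h1 : (0 : ℝ) < j := by exact_mod_cast hj
    have h2 : (j : ℝ) ≤ K := by exact_mod_cast hjK
    have := Real.pi_pos
    unfold lamSeq
    gcongr
  refine Nat.ceil_mono (mul_le_mul_of_nonneg_left ?_ (by positivity))
  refine Real.log_le_log (div_pos two_pos (hK.trans_le hle)) ?_
  gcongr

open Classical in
lemma val_andThen_estSafety_le {α : Type u} (M : MarkovModel S) {ε l : ℝ} (hε : 0 < ε)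
    (hl : 0 < l) (F : Finset S) {φ : Option α → ℝ≥0∞} {w B : ℝ≥0∞} {g : ℝ → Prog (Option α)}
    (hg : ∀ d, |d - escapeProb M F| ≤ ε → val φ w (g d) ≤ B) :
    val φ w (andThen (estSafety M ε l F) fun d =>
        if |d - escapeProb M F| ≤ ε then g d else ret none)
      ≤ w * estSamples ε l + B + φ none * ENNReal.ofReal l := by
  rw [val_andThen]
  refine (expect_mono_of_support (g := fun r => (w * estSamples ε l + B)
    + φ none * if |r.1 - escapeProb M F| ≤ ε then 0 else 1) fun r hr => ?_).trans ?_
  · obtain ⟨d, c⟩ := r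
    rw [(ensures_estSafety M ε l F d c hr).1]
    dsimp only
    by_cases h : |d - escapeProb M F| ≤ ε
    · rw [if_pos h, if_pos h, mul_zero, add_zero]
      exact add_le_add le_rfl (hg d h)
    · rw [if_neg h, if_neg h, mul_one, val_ret]
      gcongr
      exact le_self_add
  · rw [expect_add, expect_const, expect_mul_left]
    gcongr
    convert expect_estSafety_deviation_le M F hε hl

/-- Weight `w₁` for failure, and weight `w₂` for each state of the output. -/
def outVal (w₁ w₂ : ℝ≥0∞) : Option (Finset S) → ℝ≥0∞
  | none => w₁
  | some F => w₂ * F.card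

/-- The potential that bounds the expected value of the loop. -/
def loopPot (G : Finset S) (lam : ℝ) (K T : ℕ) (w₁ w₂ a : ℝ≥0∞) (fuel : ℕ) (F : Finset S)
    (j : ℕ) : ℝ≥0∞ :=
  a * missing G F
    + (w₁ * (ENNReal.ofReal (lamTail lam j) + j / K + (T - fuel : ℕ) / T) + w₂ * F.card)

-- Induction on the fuel. The failure part of the potential reserves the error probability of all
-- future estimates, and `j / K` and `(T - fuel) / T` reach `1` by the time the respective guard
-- aborts, so that `w₁` is covered there. An iteration costs `w₁ / T + w₃`; an acceptance costs `w₁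
-- / K` and the samples of an estimate, bounded by those of the `K`-th one. These are the `σ` and
-- `κ` of `expect_iteration_le`.
open Classical in
lemma val_guardedLoop_le (M : MarkovModel S) {ρ ε lam : ℝ} {G : Finset S} {K T : ℕ}
    {w₁ w₂ w₃ a : ℝ≥0∞} (hρ : 0 < ρ) (hε : 0 < ε) (hlam : 0 < lam)
    (hG : IsSafe M ρ (G : Set S)) (hK : 0 < K) (hT : 0 < T)
    (hw₁ : w₁ ≠ ∞) (hw₂ : w₂ ≠ ∞) (hw₃ : w₃ ≠ ∞)
    (ha : a = (w₁ / T + w₃) / ENNReal.ofReal ρ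
      + 2 * ((w₁ / K + w₃ * estSamples ε (lamSeq lam K)) + w₂))
    (fuel : ℕ) (F : Finset S) (j : ℕ) (d : ℝ) (hfuel : fuel ≤ T) (hj : 1 ≤ j)
    (hd : 2 * ρ + ε < d → 2 * ρ ≤ escapeProb M F) :
    val (outVal w₁ w₂) w₃ (guardedLoop M ρ ε lam K fuel F j d)
      ≤ loopPot G lam K T w₁ w₂ a fuel F j := by
  have hT0 : (T : ℝ≥0∞) ≠ 0 := by exact_mod_cast hT.ne'
  have hK0 : (K : ℝ≥0∞) ≠ 0 := by exact_mod_cast hK.ne'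
  induction fuel generalizing F j d with
  | zero =>
    rw [guardedLoop, val_ret, loopPot, outVal, Nat.sub_zero,
      ENNReal.div_self hT0 (ENNReal.natCast_ne_top T)]
    calc w₁ = w₁ * 1 := (mul_one _).symm
      _ ≤ w₁ * (ENNReal.ofReal (lamTail lam j) + j / K + 1) := by
          gcongr
          exact le_add_self
      _ ≤ _ := le_add_left le_self_add
  | succ fuel ih =>
    rw [guardedLoop, val_andThen_compute]
    by_cases hcont : d > 2 * ρ + ε
    swap
    · rw [decide_eq_false hcont, if_neg Bool.false_ne_true, val_ret, loopPot, outVal]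
      exact le_add_left le_add_self
    rw [decide_eq_true hcont, if_pos rfl, sampleTraj, val_andThen_prim]
    set κ := w₁ / K + w₃ * estSamples ε (lamSeq lam K) with hκ
    set β := w₁ * (ENNReal.ofReal (lamTail lam j) + j / K + (T - fuel : ℕ) / T) + w₂ * F.card
      with hβ
    have hfuel' : fuel ≤ T := (Nat.le_succ _).trans hfuel
    have hrej : val (outVal w₁ w₂) w₃ (guardedLoop M ρ ε lam K fuel F j d)
        ≤ a * missing G F + β := ih F j d hfuel' hj hd
    have hacc : ∀ τ : List S, val (outVal w₁ w₂) w₃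
        (andThen (addStates τ F) fun F' =>
          andThen (compute (lamSeq lam j)) fun l =>
          andThen (compute (j + 1)) fun j' =>
          if j ≤ K then
            andThen (estSafety M ε l F') fun d' =>
            if |d' - escapeProb M F'| ≤ ε then guardedLoop M ρ ε lam K fuel F' j' d'
            else ret none
          else ret none)
        ≤ a * missing G (F ∪ τ.toFinset) + β + κ + w₂ * (freshStates F τ).card := by
      intro τ
      obtain ⟨e, he, he0, -⟩ := addStates_eq τ F
      rw [he, val_andThen_pure, he0, Nat.cast_zero, mul_zero, zero_add, val_andThen_compute,
        val_andThen_compute]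
      by_cases hjK : j ≤ K
      · rw [if_pos hjK]
        refine (val_andThen_estSafety_le M hε (lamSeq_pos hlam hj) _ fun d' hd' =>
          ih (F ∪ τ.toFinset) (j + 1) d' hfuel' (by omega) fun h => ?_).trans ?_
        · have := (abs_le.1 hd').2
          linarith
        have hcard : ((F ∪ τ.toFinset).card : ℝ≥0∞) = F.card + (freshStates F τ).card := by
          rw [← Finset.union_sdiff_self_eq_union, Finset.card_union_of_disjoint
            Finset.disjoint_sdiff]
          simp [freshStates]
        have hest : (estSamples ε (lamSeq lam j) : ℝ≥0∞) ≤ estSamples ε (lamSeq lam K) := by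
          exact_mod_cast estSamples_lamSeq_mono hlam hj hjK
        have htail : ENNReal.ofReal (lamTail lam (j + 1)) + ENNReal.ofReal (lamSeq lam j)
            ≤ ENNReal.ofReal (lamTail lam j) := by
          rw [← ENNReal.ofReal_add (lamTail_nonneg hlam (by omega)) (lamSeq_pos hlam hj).le,
            add_comm]
          exact ENNReal.ofReal_le_ofReal (lamSeq_add_lamTail_le hlam hj)
        rw [loopPot, outVal, hcard, hβ, hκ]
        push_cast
        set L := ENNReal.ofReal (lamTail lam (j + 1))
        set l := ENNReal.ofReal (lamSeq lam j)
        calc _ = a * missing G (F ∪ τ.toFinset)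
              + (w₁ * ((L + l) + j / K + (T - fuel : ℕ) / T) + w₂ * F.card)
              + (w₁ / K + w₃ * estSamples ε (lamSeq lam j)) + w₂ * (freshStates F τ).card := by
              push_cast
              simp only [div_eq_mul_inv]
              ring
          _ ≤ _ := by
              push_cast
              gcongr
      · rw [if_neg hjK, val_ret, outVal]
        have h1 : (1 : ℝ≥0∞) ≤ j / K := by
          rw [ENNReal.le_div_iff_mul_le (Or.inl hK0) (Or.inl (ENNReal.natCast_ne_top K)), one_mul]
          exact_mod_cast (not_le.1 hjK).le
        calc w₁ = w₁ * 1 := (mul_one _).symm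
          _ ≤ w₁ * (ENNReal.ofReal (lamTail lam j) + j / K + (T - fuel : ℕ) / T) := by
              gcongr
              exact le_add_right (le_add_left h1)
          _ ≤ β := le_self_add
          _ ≤ _ := le_add_right (le_add_right le_add_self)
    have hiter := expect_iteration_le M hρ hG (hd hcont) β (σ := w₁ / T + w₃) (κ := κ) (γ := w₂)
      (ENNReal.add_ne_top.2 ⟨ENNReal.div_ne_top hw₁ hK0,
        ENNReal.mul_ne_top hw₃ (ENNReal.natCast_ne_top _)⟩) hw₂ ha
    have hfin : w₁ / T ≠ ∞ := ENNReal.div_ne_top hw₁ hT0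
    refine (ENNReal.add_le_add_iff_right hfin).1 ?_
    -- One unit of fuel is worth `w₁ / T`; it is added on both sides because subtraction in `ℝ≥0∞`
    -- is truncated.
    have hpot : loopPot G lam K T w₁ w₂ a (fuel + 1) F j + w₁ / T = a * missing G F + β := by
      have : T - fuel = (T - (fuel + 1)) + 1 := by omega
      rw [loopPot, hβ, this]
      push_cast
      simp only [div_eq_mul_inv]
      ring
    rw [hpot]
    refine le_trans ?_ hiter
    rw [Nat.cast_one, mul_one, add_comm (w₁ / T), ← add_assoc, add_comm w₃]
    gcongr with τ
    refine expect_mono fun τ => ?_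
    obtain ⟨e, he, he0, -⟩ := newStates_eq F τ ∅
    rw [he, val_andThen_pure, he0, Nat.cast_zero, mul_zero, zero_add, Finset.empty_union,
      tableSize, prim_pure, val_andThen_pure, Nat.cast_zero, mul_zero, zero_add,
      val_andThen_compute]
    have hfresh : τ.toFinset \ F = freshStates F τ := rfl
    rw [hfresh]
    -- A trajectory without new states is never accepted, in agreement with `acceptProb = 0⁻¹ = 0`.
    by_cases h0 : (freshStates F τ).card = 0
    · rw [decide_eq_false (not_not.2 h0), if_neg Bool.false_ne_true]
      simpa [acceptProb, h0] using hrej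
    · rw [decide_eq_true h0, if_pos rfl, val_andThen, expect_coin]
      simp only [if_true, Bool.false_eq_true, if_false, Nat.cast_zero, mul_zero, zero_add]
      exact add_le_add (mul_le_mul_right (hacc τ) _) (mul_le_mul_right hrej _)

end LoopBound

/-! ### Complete guarded runs, with either initialization. -/

section GuardedRuns

variable {S : Type u}

/-- *Finding SafeZone* with the guarded loop. -/
def guardedFind (M : MarkovModel S) (ρ ε lam : ℝ) (K fuel : ℕ) : Prog (Option (Finset S)) :=
  andThen (tableInsert ∅ M.s₀) fun F =>
  andThen (compute (1 : ℕ)) fun j =>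
  andThen (compute (1 : ℝ)) fun d =>
  guardedLoop M ρ ε lam K fuel F j d

open Classical in
/-- The variant with initial estimate, with the guarded loop. -/
def guardedFindEst (M : MarkovModel S) (ρ ε lam : ℝ) (K fuel : ℕ) : Prog (Option (Finset S)) :=
  andThen (tableInsert ∅ M.s₀) fun F =>
  andThen (compute (lamSeq lam 1)) fun l =>
  andThen (compute (2 : ℕ)) fun j =>
  andThen (estSafety M ε l F) fun d =>
  if |d - escapeProb M F| ≤ ε then guardedLoop M ρ ε lam K fuel F j d else ret none

lemma dominated_guardedFind (M : MarkovModel S) (ρ ε lam : ℝ) (K fuel : ℕ) :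
    Dominated (guardedFind M ρ ε lam K fuel) (findSafeZone M ρ ε lam fuel) :=
  dominated_andThen fun _ => dominated_andThen fun _ => dominated_andThen fun _ =>
    dominated_guardedLoop _ _ _ _ _ _ _ _ _

lemma dominated_guardedFindEst (M : MarkovModel S) (ρ ε lam : ℝ) (K fuel : ℕ) :
    Dominated (guardedFindEst M ρ ε lam K fuel) (findSafeZoneEst M ρ ε lam fuel) :=
  dominated_andThen fun _ => dominated_andThen fun _ => dominated_andThen fun _ =>
    dominated_andThen fun _ => dominated_ite_none (dominated_guardedLoop _ _ _ _ _ _ _ _ _)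

/-- What holds surely for a guarded run: its output is safe and its running time is linear in its
number of samples. -/
def SureBounds (M : MarkovModel S) (ρ ε : ℝ) (A B : ℕ) (out : Option (Finset S)) (c : Cost) :
    Prop :=
  (∀ F, out = some F → escapeProb M F ≤ 2 * ρ + 2 * ε) ∧ c.steps ≤ A * c.samples + B

open Classical in
lemma tableInsert_empty (s : S) : tableInsert ∅ s = PMF.pure ({s}, ⟨0, 1⟩) := by
  rw [tableInsert, prim_pure, insert_empty_eq]

lemma ensures_guardedFind (M : MarkovModel S) {ρ ε lam : ℝ} (K fuel : ℕ) (hε : 0 < ε) :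
    Ensures (guardedFind M ρ ε lam K fuel) (SureBounds M ρ ε (13 * (M.H + 1)) 6) := by
  refine ensures_andThen (Q := fun _ d => d = ⟨0, 1⟩) (ensures_prim fun _ _ => rfl) ?_
  rintro F - rfl
  refine ensures_andThen (Q := fun _ d => d = ⟨0, 1⟩) (ensures_compute rfl) ?_
  rintro j - rfl
  refine ensures_andThen (Q := fun x d => x = 1 ∧ d = ⟨0, 1⟩) (ensures_compute ⟨rfl, rfl⟩) ?_
  rintro d - ⟨rfl, rfl⟩
  refine (ensures_guardedLoop M K fuel F j 1 fun h => ?_).mono fun out c h => ⟨h.1, ?_⟩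
  · have := escapeProb_le_one M (F : Set S)
    linarith
  · have := h.2
    simp only [Cost.steps_add, Cost.samples_add, zero_add]
    omega

lemma ensures_guardedFindEst (M : MarkovModel S) {ρ ε lam : ℝ} (K fuel : ℕ) :
    Ensures (guardedFindEst M ρ ε lam K fuel) (SureBounds M ρ ε (13 * (M.H + 1)) 6) := by
  refine ensures_andThen (Q := fun _ d => d = ⟨0, 1⟩) (ensures_prim fun _ _ => rfl) ?_
  rintro F - rfl
  refine ensures_andThen (Q := fun _ d => d = ⟨0, 1⟩) (ensures_compute rfl) ?_
  rintro l - rfl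
  refine ensures_andThen (Q := fun _ d => d = ⟨0, 1⟩) (ensures_compute rfl) ?_
  rintro j - rfl
  refine ensures_andThen (ensures_estSafety M ε l F) ?_
  rintro d c₁ ⟨hs, ht⟩
  have key : c₁.steps ≤ 2 * (M.H * c₁.samples) + 3 * c₁.samples + 2 := by
    rw [hs]
    refine ht.trans (le_of_eq ?_)
    ring
  split_ifs with hest
  · refine (ensures_guardedLoop M K fuel F j d fun h => ?_).mono fun out c h => ⟨h.1, ?_⟩
    · have := (abs_le.1 hest).1
      linarith
    · have := h.2
      simp only [Cost.steps_add, Cost.samples_add, add_mul, mul_add, mul_one, zero_add,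
        mul_assoc] at this ⊢
      omega
  · refine ensures_ret ⟨by simp, ?_⟩
    simp only [Cost.steps_add, Cost.samples_add, add_mul, mul_add, mul_one, zero_add,
        mul_assoc, Cost.steps_zero, Cost.samples_zero]
    omega

lemma val_guardedFind_of_one_le (M : MarkovModel S) {ρ ε lam : ℝ} (K : ℕ) {T : ℕ} (hT : 0 < T)
    (h : 1 ≤ 2 * ρ + ε) (φ : Option (Finset S) → ℝ≥0∞) (w : ℝ≥0∞) :
    val φ w (guardedFind M ρ ε lam K T) = φ (some {M.s₀}) := by
  obtain ⟨t, rfl⟩ := Nat.exists_eq_succ_of_ne_zero hT.ne'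
  rw [guardedFind, tableInsert_empty, val_andThen_pure, val_andThen_compute, val_andThen_compute,
    guardedLoop, val_andThen_compute, decide_eq_false (not_lt.2 h), if_neg Bool.false_ne_true,
    val_ret]
  simp

variable {M : MarkovModel S} {ρ ε lam : ℝ} {G : Finset S} {K T : ℕ} {w₁ w₂ w₃ a : ℝ≥0∞}

lemma missing_singleton_add_one {G : Finset S} {s : S} (h : s ∈ G) :
    missing G {s} + 1 = G.card := by
  classical
  rw [← Finset.card_erase_add_one h, ← Finset.sdiff_singleton_eq_erase, missing]

lemma val_guardedFind_le (hρ : 0 < ρ) (hε : 0 < ε) (hlam : 0 < lam)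
    (hG : IsSafe M ρ (G : Set S)) (hK : 0 < K) (hT : 0 < T)
    (hw₁ : w₁ ≠ ∞) (hw₂ : w₂ ≠ ∞) (hw₃ : w₃ ≠ ∞)
    (ha : a = (w₁ / T + w₃) / ENNReal.ofReal ρ
      + 2 * ((w₁ / K + w₃ * estSamples ε (lamSeq lam K)) + w₂))
    (h₀ : 2 * ρ + ε < 1 → 2 * ρ ≤ escapeProb M {M.s₀}) :
    val (outVal w₁ w₂) w₃ (guardedFind M ρ ε lam K T)
      ≤ a * missing G {M.s₀} + w₁ * (ENNReal.ofReal lam + 2 / K) + w₂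
        + w₃ * estSamples ε (lamSeq lam K) := by
  rw [guardedFind, tableInsert_empty, val_andThen_pure, val_andThen_compute, val_andThen_compute,
    Nat.cast_zero, mul_zero, zero_add]
  refine (val_guardedLoop_le M hρ hε hlam hG hK hT hw₁ hw₂ hw₃ ha T _ 1 1 le_rfl le_rfl
    (by simpa using h₀)).trans ?_
  rw [loopPot, Nat.sub_self, Nat.cast_zero, ENNReal.zero_div, add_zero, Finset.card_singleton,
    Nat.cast_one, mul_one, ← add_assoc]
  refine le_add_right ?_
  gcongr
  · exact lamTail_one_le hlam
  · exact one_le_two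

/-- No assumption on `Δ({s₀})` is needed, as an accurate initial estimate above the threshold
implies `2ρ ≤ Δ({s₀})`. Its error probability `λ₁` and the tail from `2` still fit into `lam`; its
samples are paid by the last term. -/
lemma val_guardedFindEst_le (hρ : 0 < ρ) (hε : 0 < ε) (hlam : 0 < lam)
    (hG : IsSafe M ρ (G : Set S)) (hK : 0 < K) (hT : 0 < T)
    (hw₁ : w₁ ≠ ∞) (hw₂ : w₂ ≠ ∞) (hw₃ : w₃ ≠ ∞)
    (ha : a = (w₁ / T + w₃) / ENNReal.ofReal ρ
      + 2 * ((w₁ / K + w₃ * estSamples ε (lamSeq lam K)) + w₂)) :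
    val (outVal w₁ w₂) w₃ (guardedFindEst M ρ ε lam K T)
      ≤ a * missing G {M.s₀} + w₁ * (ENNReal.ofReal lam + 2 / K) + w₂
        + w₃ * estSamples ε (lamSeq lam K) := by
  rw [guardedFindEst, tableInsert_empty, val_andThen_pure, val_andThen_compute,
    val_andThen_compute, Nat.cast_zero, mul_zero, zero_add]
  refine (val_andThen_estSafety_le M hε (lamSeq_pos hlam le_rfl) _ fun d hd =>
    val_guardedLoop_le M hρ hε hlam hG hK hT hw₁ hw₂ hw₃ ha T _ 2 d le_rfl (by omega)
      fun h => ?_).trans ?_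
  · have := (abs_le.1 hd).2
    linarith
  rw [loopPot, Nat.sub_self, Nat.cast_zero, ENNReal.zero_div, add_zero, Finset.card_singleton,
    Nat.cast_one, mul_one, outVal, Nat.cast_ofNat]
  have htail : ENNReal.ofReal (lamTail lam 2) + ENNReal.ofReal (lamSeq lam 1)
      ≤ ENNReal.ofReal lam := by
    rw [← ENNReal.ofReal_add (lamTail_nonneg hlam (by omega)) (lamSeq_pos hlam le_rfl).le,
      add_comm]
    exact ENNReal.ofReal_le_ofReal
      ((lamSeq_add_lamTail_le hlam le_rfl).trans (lamTail_one_le hlam))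
  have hest : (estSamples ε (lamSeq lam 1) : ℝ≥0∞) ≤ estSamples ε (lamSeq lam K) := by
    exact_mod_cast estSamples_lamSeq_mono hlam le_rfl hK
  calc _ = a * missing G {M.s₀} + w₁ * ((ENNReal.ofReal (lamTail lam 2)
        + ENNReal.ofReal (lamSeq lam 1)) + 2 / K) + w₂
        + w₃ * estSamples ε (lamSeq lam 1) := by ring
    _ ≤ _ := by gcongr

/-- The average bounds for one guarded run: failure probability, output size, samples. -/
structure AverageBounds (alg : Prog (Option (Finset S))) (η s b : ℝ≥0∞) : Prop where
  failure : val (outVal 1 0) 0 alg ≤ η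
  size : val (outVal 0 1) 0 alg ≤ s
  samples : val (outVal 0 0) 1 alg ≤ b

/-- The weights `(1,0,0)`, `(0,1,0)`, `(0,0,1)` are inserted. Since `s₀ ∈ G`, only `k - 1` states
are missing at the start, and the spare unit absorbs the initial terms. -/
lemma averageBounds_of_val_le {alg : Prog (Option (Finset S))} (h₀ : M.s₀ ∈ G)
    (h : ∀ w₁ w₂ w₃ a : ℝ≥0∞, w₁ ≠ ∞ → w₂ ≠ ∞ → w₃ ≠ ∞ →
      a = (w₁ / T + w₃) / ENNReal.ofReal ρ
        + 2 * ((w₁ / K + w₃ * estSamples ε (lamSeq lam K)) + w₂) →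
      val (outVal w₁ w₂) w₃ alg
        ≤ a * missing G {M.s₀} + w₁ * (ENNReal.ofReal lam + 2 / K) + w₂
          + w₃ * estSamples ε (lamSeq lam K)) :
    AverageBounds alg ((1 / T / ENNReal.ofReal ρ + 2 / K) * G.card + ENNReal.ofReal lam)
      (2 * G.card) ((1 / ENNReal.ofReal ρ + 2 * estSamples ε (lamSeq lam K)) * G.card) := by
  have hk : (G.card : ℝ≥0∞) = missing G {M.s₀} + 1 := by
    exact_mod_cast (missing_singleton_add_one h₀).symm
  rw [hk]
  set n : ℝ≥0∞ := (missing G {M.s₀} : ℝ≥0∞)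
  refine ⟨(h 1 0 0 _ (by simp) (by simp) (by simp) rfl).trans ?_,
    (h 0 1 0 _ (by simp) (by simp) (by simp) rfl).trans ?_,
    (h 0 0 1 _ (by simp) (by simp) (by simp) rfl).trans ?_⟩
  · simp only [zero_mul, add_zero, one_mul]
    calc _ = (1 / T / ENNReal.ofReal ρ + 2 / K) * n + 2 / K + ENNReal.ofReal lam := by
          simp only [div_eq_mul_inv]
          ring
      _ ≤ _ := by
          rw [mul_add, mul_one]
          gcongr
          exact le_add_self
  · simp only [zero_mul, add_zero, zero_add, ENNReal.zero_div, mul_one, mul_add]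
    gcongr
    exact one_le_two
  · simp only [zero_mul, add_zero, zero_add, ENNReal.zero_div, one_mul, mul_add, mul_one]
    gcongr
    refine le_add_left ?_
    rw [two_mul]
    exact le_self_add

end GuardedRuns

/-! ### Independent repetition and choice of the smallest output. -/

section Boosting

variable {S : Type u}

lemma dominated_keepSmallest {alg alg' : Prog (Option (Finset S))} (h : Dominated alg' alg)
    (n : ℕ) (best : Finset S) : Dominated (keepSmallest alg' n best) (keepSmallest alg n best) := by
  induction n generalizing best with
  | zero => exact Dominated.refl _
  | succ n ih =>
    refine dominated_andThen_option h rfl fun out => ?_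
    cases out with
    | none => exact Dominated.refl _
    | some F =>
      exact dominated_andThen fun a => dominated_andThen fun b => dominated_andThen fun _ => ih _

lemma dominated_smallestOf {alg alg' : Prog (Option (Finset S))} (h : Dominated alg' alg)
    (m : ℕ) : Dominated (smallestOf alg' m) (smallestOf alg m) := by
  refine dominated_andThen_option h rfl fun out => ?_
  cases out with
  | none => exact Dominated.refl _
  | some F => exact dominated_keepSmallest h _ _

variable {alg : Prog (Option (Finset S))}

lemma ensures_keepSmallest {M : MarkovModel S} {ρ ε : ℝ} {A B : ℕ}
    (h : Ensures alg (SureBounds M ρ ε A B)) (n : ℕ) (best : Finset S)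
    (hb : escapeProb M best ≤ 2 * ρ + 2 * ε) :
    Ensures (keepSmallest alg n best) (SureBounds M ρ ε A ((B + 3) * n)) := by
  induction n generalizing best with
  | zero =>
    refine ensures_ret ⟨?_, by simp [Cost.steps_zero]⟩
    rintro F ⟨⟩
    exact hb
  | succ n ih =>
    refine ensures_andThen h ?_
    rintro (_ | F) c ⟨h1, h2⟩
    · refine ensures_ret ⟨by simp, ?_⟩
      simp only [Cost.steps_add, Cost.samples_add, Cost.steps_zero, Cost.samples_zero, add_zero,
        mul_add]
      omega
    · refine ensures_andThen (Q := fun _ d => d = ⟨0, 1⟩) (ensures_prim fun _ _ => rfl) ?_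
      rintro a - rfl
      refine ensures_andThen (Q := fun _ d => d = ⟨0, 1⟩) (ensures_prim fun _ _ => rfl) ?_
      rintro b - rfl
      refine ensures_andThen (Q := fun F' d => (F' = if a < b then F else best) ∧ d = ⟨0, 1⟩)
        (ensures_compute ⟨rfl, rfl⟩) ?_
      rintro F' - ⟨rfl, rfl⟩
      refine (ih _ ?_).mono fun out d hd => ⟨hd.1, ?_⟩
      · split_ifs
        exacts [h1 F rfl, hb]
      · have := hd.2
        simp only [Cost.steps_add, Cost.samples_add, zero_add, mul_add] at this ⊢
        omega

lemma ensures_smallestOf {M : MarkovModel S} {ρ ε : ℝ} {A B : ℕ}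
    (h : Ensures alg (SureBounds M ρ ε A B)) {m : ℕ} (hm : 1 ≤ m) :
    Ensures (smallestOf alg m) (SureBounds M ρ ε A ((B + 3) * m)) := by
  obtain ⟨n, rfl⟩ := Nat.exists_eq_add_of_le' hm
  refine ensures_andThen h ?_
  rintro (_ | F) c ⟨h1, h2⟩
  · refine ensures_ret ⟨by simp, ?_⟩
    simp only [Cost.steps_add, Cost.samples_add, Cost.steps_zero, Cost.samples_zero, add_zero,
      mul_add]
    omega
  · refine (ensures_keepSmallest h n F (h1 F rfl)).mono fun out d hd => ⟨hd.1, ?_⟩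
    have := hd.2
    simp only [Cost.steps_add, Cost.samples_add, mul_add] at this ⊢
    omega

/-- With weight `0` on sizes the choice of the output is irrelevant: failures obey a union bound and
samples add up. -/
lemma val_keepSmallest_le {w₁ w₃ R : ℝ≥0∞} (h : val (outVal w₁ 0) w₃ alg ≤ R) (n : ℕ)
    (best : Finset S) : val (outVal w₁ 0) w₃ (keepSmallest alg n best) ≤ n * R := by
  induction n generalizing best with
  | zero => simp [keepSmallest, val_ret, outVal]
  | succ n ih =>
    rw [keepSmallest, val_andThen]
    refine (expect_mono (g := fun r => (outVal w₁ 0 r.1 + w₃ * r.2.samples) + n * R)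
      fun r => ?_).trans ?_
    · obtain ⟨_ | F, c⟩ := r
      · dsimp only
        rw [val_ret, add_comm]
        exact le_self_add
      · simp only [tableSize, prim_pure, val_andThen_pure, val_andThen_compute, Nat.cast_zero,
          mul_zero, zero_add, outVal, zero_mul]
        gcongr
        exact ih _
    · rw [expect_add, expect_const, Nat.cast_succ, add_mul, one_mul, add_comm]
      gcongr
      exact h

lemma val_smallestOf_le {w₁ w₃ R : ℝ≥0∞} (h : val (outVal w₁ 0) w₃ alg ≤ R) {m : ℕ}
    (hm : 1 ≤ m) : val (outVal w₁ 0) w₃ (smallestOf alg m) ≤ m * R := by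
  obtain ⟨n, rfl⟩ := Nat.exists_eq_add_of_le' hm
  rw [smallestOf, val_andThen]
  refine (expect_mono (g := fun r => (outVal w₁ 0 r.1 + w₃ * r.2.samples) + n * R)
    fun r => ?_).trans ?_
  · obtain ⟨_ | F, c⟩ := r
    · dsimp only
      rw [val_ret, add_comm]
      exact le_self_add
    · simp only [outVal, zero_mul, zero_add]
      gcongr
      exact val_keepSmallest_le h n F
  · rw [expect_add, expect_const, Nat.cast_succ, add_mul, one_mul, add_comm]
    gcongr
    exact h

open Classical in
/-- The indicator of an output with more than `t` states. -/
def largeOut (t : ℝ) : Option (Finset S) → ℝ≥0∞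
  | none => 0
  | some F => if t < F.card then 1 else 0

/-- The smallest output is large only if `best` and the outputs of all runs are; an aborted run
counts as not large, its probability being charged to failure. -/
lemma val_keepSmallest_large_le {t : ℝ} {θ : ℝ≥0∞} (h : val (largeOut t) 0 alg ≤ θ) (n : ℕ)
    (best : Finset S) :
    val (largeOut t) 0 (keepSmallest alg n best) ≤ θ ^ n * largeOut t (some best) := by
  induction n generalizing best with
  | zero => simp [keepSmallest, val_ret]
  | succ n ih =>
    rw [keepSmallest, val_andThen]
    refine (expect_mono (g := fun r => (θ ^ n * largeOut t (some best)) *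
      (largeOut t r.1 + 0 * r.2.samples)) fun r => ?_).trans ?_
    · obtain ⟨_ | F, c⟩ := r
      · dsimp only
        rw [val_ret]
        simp [largeOut]
      · simp only [tableSize, prim_pure, val_andThen_pure, val_andThen_compute, Nat.cast_zero,
          zero_mul, zero_add, add_zero]
        refine (ih _).trans ?_
        rw [mul_assoc]
        gcongr
        by_cases hlt : F.card < best.card
        · rw [if_pos hlt]
          have : (F.card : ℝ) < best.card := by exact_mod_cast hlt
          by_cases h1 : t < F.card
          · simp [largeOut, h1, h1.trans this]
          · simp [largeOut, h1]
        · rw [if_neg hlt]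
          have : (best.card : ℝ) ≤ F.card := by exact_mod_cast not_lt.1 hlt
          by_cases h1 : t < best.card
          · simp [largeOut, h1, h1.trans_le this]
          · simp [largeOut, h1]
    · rw [expect_mul_left, pow_succ]
      calc θ ^ n * largeOut t (some best) * val (largeOut t) 0 alg
          ≤ θ ^ n * largeOut t (some best) * θ := by gcongr
        _ = _ := by ring

lemma val_smallestOf_large_le {t : ℝ} {θ : ℝ≥0∞} (h : val (largeOut t) 0 alg ≤ θ) {m : ℕ}
    (hm : 1 ≤ m) : val (largeOut t) 0 (smallestOf alg m) ≤ θ ^ m := by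
  obtain ⟨n, rfl⟩ := Nat.exists_eq_add_of_le' hm
  rw [smallestOf, val_andThen]
  refine (expect_mono (g := fun r => θ ^ n * (largeOut t r.1 + 0 * r.2.samples))
    fun r => ?_).trans ?_
  · obtain ⟨_ | F, c⟩ := r
    · dsimp only
      rw [val_ret]
      simp [largeOut]
    · simp only [zero_mul, zero_add, add_zero]
      exact val_keepSmallest_large_le h n F
  · rw [expect_mul_left, pow_succ]
    gcongr
    exact h

/-- Markov's inequality for the size of the output. -/
lemma val_largeOut_le {t : ℝ} (ht : 0 < t) {s : ℝ≥0∞} (h : val (outVal 0 1) 0 alg ≤ s) :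
    val (largeOut t) 0 alg ≤ s / ENNReal.ofReal t := by
  have ht0 : ENNReal.ofReal t ≠ 0 := by simpa using ht
  rw [ENNReal.le_div_iff_mul_le (Or.inl ht0) (Or.inl ENNReal.ofReal_ne_top), mul_comm]
  refine le_trans ?_ h
  rw [val, ← expect_mul_left]
  refine expect_mono fun r => ?_
  obtain ⟨_ | F, c⟩ := r
  · simp [largeOut]
  · by_cases h1 : t < F.card
    · simp only [largeOut, h1, if_true, zero_mul, add_zero, mul_one, outVal, one_mul]
      rw [← ENNReal.ofReal_natCast]
      exact ENNReal.ofReal_le_ofReal h1.le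
    · simp [largeOut, h1]

/-- Independent runs whose guarded versions obey the bounds return a small safe set at the
expected cost. -/
lemma le_haltProb_smallestOf {alg : ℕ → Prog (Option (Finset S))}
    {alg' : Prog (Option (Finset S))} {T : ℕ} (hdom : Dominated alg' (alg T))
    {M : MarkovModel S} {ρ ε : ℝ} {A B : ℕ} (hsure : Ensures alg' (SureBounds M ρ ε A B))
    {η s b : ℝ≥0∞} (hav : AverageBounds alg' η s b) {m : ℕ} (hm : 1 ≤ m) {t X : ℝ} (ht : 0 < t)
    (hX : 0 < X) (h₁ : m * η ≤ ENNReal.ofReal 0.006)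
    (h₂ : (s / ENNReal.ofReal t) ^ m ≤ ENNReal.ofReal 0.002)
    (h₃ : m * b ≤ ENNReal.ofReal (0.002 * X)) {good : Finset S → Cost → Prop}
    (hgood : ∀ (F : Finset S) (c : Cost), escapeProb M F ≤ 2 * ρ + 2 * ε → (F.card : ℝ) ≤ t →
      (c.samples : ℝ) ≤ X → c.steps ≤ A * c.samples + (B + 3) * m → good F c) :
    ENNReal.ofReal 0.99 ≤ haltProb (fun fuel => smallestOf (alg fuel) m) good := by
  classical
  refine le_trans ?_ (le_iSup _ T)
  rw [toOuterMeasure_eq_expect]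
  refine le_trans ?_ (dominated_smallestOf hdom m _ fun c => ?_)
  swap
  · rw [Set.indicator_of_notMem]
    simp
  set x := smallestOf alg' m
  set I : Option (Finset S) × Cost → ℝ≥0∞ :=
    Set.indicator {r | ∃ a, r.1 = some a ∧ good a r.2} 1
  have hX0 : ENNReal.ofReal X ≠ 0 := by simpa using hX
  -- Pointwise on the support one summand is at least `1`: success, failure, a large output, or
  -- samples divided by `X` (Markov).
  have hone : (1 : ℝ≥0∞) ≤ expect x fun r => I r + ((outVal 1 0 r.1 + 0 * r.2.samples)
      + (largeOut t r.1 + 0 * r.2.samples)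
      + (ENNReal.ofReal X)⁻¹ * (outVal 0 0 r.1 + 1 * r.2.samples)) := by
    rw [← expect_const x 1]
    refine expect_mono_of_support fun r hr => ?_
    obtain ⟨out, c⟩ := r
    rw [expect_const]
    obtain ⟨hs1, hs2⟩ := ensures_smallestOf hsure hm out c hr
    cases out with
    | none => exact le_add_left (le_add_right (le_add_right (by simp [outVal])))
    | some F =>
      by_cases ht' : t < F.card
      · refine le_add_left (le_add_right (le_add_left ?_))
        simp [largeOut, ht']
      by_cases hX' : X < c.samples
      · refine le_add_left (le_add_left ?_)
        simp only [outVal, zero_mul, zero_add, one_mul]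
        rw [mul_comm, ← div_eq_mul_inv, ENNReal.le_div_iff_mul_le (Or.inl hX0)
          (Or.inl ENNReal.ofReal_ne_top), one_mul, ← ENNReal.ofReal_natCast]
        exact ENNReal.ofReal_le_ofReal hX'.le
      · refine le_add_right ?_
        have hmem : ((some F, c) : Option (Finset S) × Cost)
            ∈ {r : Option (Finset S) × Cost | ∃ a, r.1 = some a ∧ good a r.2} :=
          ⟨F, rfl, hgood F c (hs1 F rfl) (not_lt.1 ht') (not_lt.1 hX') hs2⟩
        exact (Set.indicator_of_mem hmem (1 : Option (Finset S) × Cost → ℝ≥0∞)).ge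
  rw [expect_add, expect_add, expect_add, expect_mul_left] at hone
  have b1 : expect x (fun r => outVal 1 0 r.1 + 0 * r.2.samples) ≤ ENNReal.ofReal 0.006 :=
    (val_smallestOf_le hav.failure hm).trans h₁
  have b2 : expect x (fun r => largeOut t r.1 + 0 * r.2.samples) ≤ ENNReal.ofReal 0.002 :=
    (val_smallestOf_large_le (val_largeOut_le ht hav.size) hm).trans h₂
  have b3 : (ENNReal.ofReal X)⁻¹ * expect x (fun r => outVal 0 0 r.1 + 1 * r.2.samples)
      ≤ ENNReal.ofReal 0.002 := by
    refine (mul_le_mul_right ((val_smallestOf_le hav.samples hm).trans h₃) _).trans ?_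
    rw [mul_comm 0.002 X, ENNReal.ofReal_mul hX.le, ← mul_assoc,
      ENNReal.inv_mul_cancel hX0 ENNReal.ofReal_ne_top, one_mul]
  have htot : (1 : ℝ≥0∞) ≤ expect x I + ENNReal.ofReal 0.01 := by
    refine hone.trans ?_
    gcongr
    refine (add_le_add (add_le_add b1 b2) b3).trans (le_of_eq ?_)
    rw [← ENNReal.ofReal_add (by norm_num) (by norm_num),
      ← ENNReal.ofReal_add (by norm_num) (by norm_num)]
    norm_num
  refine (ENNReal.add_le_add_iff_right (ENNReal.ofReal_ne_top (r := 0.01))).1 ?_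
  refine le_trans (le_of_eq ?_) htot
  rw [← ENNReal.ofReal_add (by norm_num) (by norm_num)]
  norm_num

end Boosting

/-! ### Existence of optimal safe sets and their initial state. -/

section SafeSets

variable {S : Type u}

/-- Finitely many trajectories carry more than `1 - ρ` of the mass of a discrete law; the union of
their states is safe. Without this, `kStar` could be the junk value `sInf ∅ = 0`. -/
lemma exists_finset_isSafe (M : MarkovModel S) {ρ : ℝ} (hρ : 0 < ρ) :
    ∃ G : Finset S, IsSafe M ρ (G : Set S) := by
  classical
  have hlt : 1 - ENNReal.ofReal ρ < ⨆ s : Finset (List S), ∑ τ ∈ s, M.trajLaw τ := by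
    rw [← ENNReal.tsum_eq_iSup_sum, PMF.tsum_coe]
    exact ENNReal.sub_lt_self ENNReal.one_ne_top one_ne_zero (by simpa using hρ)
  obtain ⟨s, hs⟩ := lt_iSup_iff.1 hlt
  refine ⟨s.biUnion List.toFinset, ?_⟩
  set G := s.biUnion List.toFinset with hG
  have hsum : ∑ τ ∈ s, M.trajLaw τ = expect M.trajLaw fun τ => if τ ∈ s then 1 else 0 := by
    rw [expect, tsum_eq_sum (s := s)]
    · exact Finset.sum_congr rfl fun τ hτ => by simp [hτ]
    · intro τ hτ
      simp [hτ]
  have h1 : ENNReal.ofReal (escapeProb M G) + ∑ τ ∈ s, M.trajLaw τ ≤ 1 := by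
    rw [hsum, ofReal_escapeProb, ← expect_add]
    refine (expect_mono (g := fun _ => 1) fun τ => ?_).trans_eq (expect_const _ 1)
    by_cases hτ : τ ∈ s
    · rw [escapeInd_of_subset, if_pos hτ, zero_add]
      intro x hx
      simp only [hG, Finset.coe_biUnion, Set.mem_iUnion, Finset.mem_coe, List.mem_toFinset]
      exact ⟨τ, hτ, hx⟩
    · rw [if_neg hτ, add_zero]
      exact escapeInd_le_one _ _
  have hfin : ∑ τ ∈ s, M.trajLaw τ ≠ ∞ :=
    ne_top_of_le_ne_top ENNReal.one_ne_top (le_add_self.trans h1)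
  have h2 : ENNReal.ofReal (escapeProb M G) ≤ ENNReal.ofReal ρ := by
    refine (ENNReal.add_le_add_iff_right hfin).1 (h1.trans ?_)
    exact tsub_le_iff_left.1 hs.le
  exact (ENNReal.ofReal_le_ofReal_iff hρ.le).1 h2

lemma exists_isSafe_card_eq_kStar (M : MarkovModel S) {ρ : ℝ} (hρ : 0 < ρ) :
    ∃ G : Finset S, IsSafe M ρ (G : Set S) ∧ G.card = kStar M ρ := by
  obtain ⟨G, hG⟩ := exists_finset_isSafe M hρ
  exact Nat.sInf_mem (s := {k | ∃ F : Finset S, IsSafe M ρ (F : Set S) ∧ F.card = k})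
    ⟨G.card, G, hG, rfl⟩

lemma initial_mem_of_isSafe {M : MarkovModel S} {ρ : ℝ} {G : Set S} (hρ : ρ < 1)
    (hG : IsSafe M ρ G) : M.s₀ ∈ G := by
  by_contra h
  have h1 : ENNReal.ofReal (escapeProb M G) = 1 := by
    rw [ofReal_escapeProb]
    refine le_antisymm ((expect_mono (escapeInd_le_one G)).trans_eq (expect_const _ 1)) ?_
    rw [← expect_const M.trajLaw 1]
    refine expect_mono_of_support fun τ hτ => ?_
    rw [escapeInd_of_not_subset]
    exact fun h' => h (h' _ (trajLaw_support M hτ).2)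
  have h2 : escapeProb M G = 1 := by simpa using h1
  have : escapeProb M G ≤ ρ := hG
  linarith

end SafeSets

/-! ### Explicit constants. -/

section Numerics

lemma natCeil_thirty_div_bounds {δ : ℝ} (hδ : 0 < δ) (hδ1 : δ < 1) :
    30 / δ ≤ ⌈30 / δ⌉₊ ∧ (⌈30 / δ⌉₊ : ℝ) ≤ 31 / δ := by
  refine ⟨Nat.le_ceil _, (Nat.ceil_lt_add_one (by positivity)).le.trans ?_⟩
  rw [div_add_one hδ.ne']
  gcongr
  linarith

/-- The sample size of the estimates is logarithmic in `x`. -/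
lemma estSamples_le {ε δ x : ℝ} (hε : 0 < ε) (hδ : 0 < δ) {k m : ℕ} (hk : 1 ≤ k)
    (hm : 1 ≤ m) (hmδ : (m : ℝ) ≤ 31 / δ) (hδ1 : δ < 1) (hx2 : 2 ≤ x) (hx : k / δ ≤ x) :
    (estSamples ε (lamSeq (0.01 / (3 * (m : ℝ))) (2000 * k * m)) : ℝ)
      ≤ 26 * Real.log x / ε ^ 2 + 1 := by
  have hk1 : (1 : ℝ) ≤ k := by exact_mod_cast hk
  have hm1 : (1 : ℝ) ≤ m := by exact_mod_cast hm
  have hpi := Real.pi_pos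
  have hpi2 : Real.pi ^ 2 ≤ 10 := by nlinarith [Real.pi_lt_d2, Real.pi_gt_three]
  have hl : 0 < lamSeq (0.01 / (3 * (m : ℝ))) (2000 * k * m) :=
    lamSeq_pos (by positivity) (Nat.one_le_iff_ne_zero.2 (by positivity))
  have e : 2 / lamSeq (0.01 / (3 * (m : ℝ))) (2000 * k * m)
      = 1600000000 * Real.pi ^ 2 * (k ^ 2 * (m : ℝ) ^ 3) := by
    rw [lamSeq]
    push_cast
    field_simp
    norm_num
  have hkm : (k : ℝ) ^ 2 * (m : ℝ) ^ 3 ≤ 31 ^ 3 * x ^ 3 := by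
    calc (k : ℝ) ^ 2 * (m : ℝ) ^ 3 ≤ k ^ 3 * (31 / δ) ^ 3 := by
          gcongr
          norm_num
      _ = 31 ^ 3 * (k / δ) ^ 3 := by ring
      _ ≤ 31 ^ 3 * x ^ 3 := by gcongr
  -- The numerical factor is below `2 ^ 49 ≤ x ^ 49`. Here `x ≥ 2` is essential: it lets the
  -- logarithm absorb the constants.
  have hpow : 2 / lamSeq (0.01 / (3 * (m : ℝ))) (2000 * k * m) ≤ x ^ 52 := by
    rw [e]
    calc 1600000000 * Real.pi ^ 2 * ((k : ℝ) ^ 2 * (m : ℝ) ^ 3)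
        ≤ 1600000000 * 10 * (31 ^ 3 * x ^ 3) := by gcongr
      _ = 1600000000 * 10 * 31 ^ 3 * x ^ 3 := by ring
      _ ≤ 2 ^ 49 * x ^ 3 := by
          gcongr
          norm_num
      _ ≤ x ^ 49 * x ^ 3 := by gcongr
      _ = x ^ 52 := by ring
  have hlog : Real.log (2 / lamSeq (0.01 / (3 * (m : ℝ))) (2000 * k * m)) ≤ 52 * Real.log x := by
    refine (Real.log_le_log (by positivity) hpow).trans_eq ?_
    rw [Real.log_pow]
    norm_num
  have hlog0 : 0 ≤ Real.log x := Real.log_nonneg (by linarith)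
  calc (estSamples ε (lamSeq (0.01 / (3 * (m : ℝ))) (2000 * k * m)) : ℝ)
      ≤ ⌈1 / (2 * ε ^ 2) * (52 * Real.log x)⌉₊ := by
        exact_mod_cast Nat.ceil_mono (mul_le_mul_of_nonneg_left hlog (by positivity))
    _ ≤ 1 / (2 * ε ^ 2) * (52 * Real.log x) + 1 := (Nat.ceil_lt_add_one (by positivity)).le
    _ = _ := by
        field_simp
        ring

/-- The bound on the number of samples, up to a constant. -/
def sampleBound (H k : ℕ) (ρ ε δ L : ℝ) : ℝ := k / (δ ^ 2 * ε ^ 2) * L + H * k / (ρ * δ ^ 2)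

lemma inv_le_sampleBound {H k : ℕ} {ρ ε δ L : ℝ} (hH : 1 ≤ H) (hk : 1 ≤ k) (hρ : 0 < ρ)
    (hρ1 : ρ < 1) (hδ : 0 < δ) (hδ1 : δ < 1) (hL : 0 ≤ L) :
    1 / δ ≤ sampleBound H k ρ ε δ L := by
  have hk1 : (1 : ℝ) ≤ k := by exact_mod_cast hk
  have hH1 : (1 : ℝ) ≤ H := by exact_mod_cast hH
  have h1 : 1 / δ ≤ H * k / (ρ * δ ^ 2) := by
    rw [div_le_div_iff₀ hδ (by positivity)]
    have : ρ * δ ≤ H * k := by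
      calc ρ * δ ≤ 1 * 1 := by gcongr
        _ ≤ H * k := by gcongr
    nlinarith
  have h2 : 0 ≤ k / (δ ^ 2 * ε ^ 2) * L := by positivity
  rw [sampleBound]
  linarith

lemma expected_samples_le {H k m : ℕ} {ρ ε δ x : ℝ} (hH : 1 ≤ H) (hk : 1 ≤ k) (hm : 1 ≤ m)
    (hmδ : (m : ℝ) ≤ 31 / δ) (hρ : 0 < ρ) (hρ1 : ρ < 1) (hε : 0 < ε) (hδ : 0 < δ) (hδ1 : δ < 1)
    (hx2 : 2 ≤ x) (hx : k / δ ≤ x) :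
    (m : ℝ≥0∞) * ((1 / ENNReal.ofReal ρ
        + 2 * estSamples ε (lamSeq (0.01 / (3 * (m : ℝ))) (2000 * k * m))) * k)
      ≤ ENNReal.ofReal (0.002 * (806000 * sampleBound H k ρ ε δ (Real.log x))) := by
  have hN := estSamples_le hε hδ hk hm hmδ hδ1 hx2 hx
  set N := estSamples ε (lamSeq (0.01 / (3 * (m : ℝ))) (2000 * k * m))
  have hlog0 : 0 ≤ Real.log x := Real.log_nonneg (by linarith)
  set L := Real.log x
  have hk1 : (1 : ℝ) ≤ k := by exact_mod_cast hk
  have hH1 : (1 : ℝ) ≤ H := by exact_mod_cast hH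
  have e : (m : ℝ≥0∞) * ((1 / ENNReal.ofReal ρ + 2 * N) * k)
      = ENNReal.ofReal (m * ((1 / ρ + 2 * N) * k)) := by
    rw [ENNReal.ofReal_mul (by positivity), ENNReal.ofReal_mul (by positivity),
      ENNReal.ofReal_add (by positivity) (by positivity), ENNReal.ofReal_div_of_pos hρ,
      ENNReal.ofReal_mul (by norm_num)]
    simp
  rw [e]
  refine ENNReal.ofReal_le_ofReal ?_
  have hρ' : 1 ≤ 1 / ρ := by
    rw [le_div_iff₀ hρ]
    linarith
  have hδ' : 1 / δ ≤ 1 / δ ^ 2 := by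
    apply one_div_le_one_div_of_le (by positivity)
    nlinarith
  -- The leading constant is `31 · 52 = 1612 = 0.002 · 806000`.
  calc (m : ℝ) * ((1 / ρ + 2 * N) * k)
      ≤ 31 / δ * ((1 / ρ + 2 * (26 * L / ε ^ 2 + 1)) * k) := by gcongr
    _ ≤ 31 / δ * ((3 * (1 / ρ) + 52 * L / ε ^ 2) * k) := by
        gcongr ?_ * (?_ * _)
        have : 2 * (26 * L / ε ^ 2 + 1) = 52 * L / ε ^ 2 + 2 := by ring
        linarith
    _ = 1 / δ * (31 * (3 * (1 * (1 / ρ)) + 52 * L / ε ^ 2) * k) := by ring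
    _ ≤ 1 / δ ^ 2 * (31 * (3 * (H * (1 / ρ)) + 52 * L / ε ^ 2) * k) := by gcongr
    _ = 1612 * (k / (δ ^ 2 * ε ^ 2) * L) + 93 * (H * k / (ρ * δ ^ 2)) := by
        field_simp
        ring
    _ ≤ 1612 * (k / (δ ^ 2 * ε ^ 2) * L) + 1612 * (H * k / (ρ * δ ^ 2)) := by
        gcongr
        norm_num
    _ = _ := by
        rw [sampleBound]
        ring

/-- For `δ < 1`, `2/(2+δ) ≤ 1 - δ/3 ≤ e^(-δ/3)`, so `m ≥ 30/δ` runs give `e⁻¹⁰`. -/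
lemma large_prob_le {δ : ℝ} {k m : ℕ} (hk : 1 ≤ k) (hδ : 0 < δ) (hδ1 : δ < 1)
    (hm : 30 / δ ≤ m) :
    (2 * (k : ℝ≥0∞) / ENNReal.ofReal ((2 + δ) * k)) ^ m ≤ ENNReal.ofReal 0.002 := by
  have hk0 : (0 : ℝ) < k := by exact_mod_cast hk
  have e : 2 * (k : ℝ≥0∞) / ENNReal.ofReal ((2 + δ) * k) = ENNReal.ofReal (2 / (2 + δ)) := by
    rw [← mul_div_mul_right 2 (2 + δ) hk0.ne', ENNReal.ofReal_div_of_pos (by positivity),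
      ENNReal.ofReal_mul zero_le_two, ENNReal.ofReal_natCast, ENNReal.ofReal_ofNat]
  rw [e, ← ENNReal.ofReal_pow (by positivity)]
  refine ENNReal.ofReal_le_ofReal ?_
  have h1 : 2 / (2 + δ) ≤ Real.exp (-(δ / 3)) := by
    refine le_trans ?_ (Real.add_one_le_exp _)
    rw [div_le_iff₀ (by positivity)]
    nlinarith
  have h2 : (10 : ℝ) ≤ m * (δ / 3) := by
    rw [div_le_iff₀ hδ] at hm
    linarith
  calc (2 / (2 + δ)) ^ m ≤ Real.exp (-(δ / 3)) ^ m := by gcongr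
    _ = Real.exp (-(m * (δ / 3))) := by
        rw [← Real.exp_nat_mul]
        congr 1
        ring
    _ ≤ Real.exp (-10) := by gcongr
    _ = (Real.exp 10)⁻¹ := Real.exp_neg _
    _ ≤ (500 : ℝ)⁻¹ := by
        gcongr
        have : Real.exp 10 = Real.exp 1 ^ 10 := by
          rw [← Real.exp_nat_mul]
          norm_num
        rw [this]
        calc (500 : ℝ) ≤ 2 ^ 10 := by norm_num
          _ ≤ Real.exp 1 ^ 10 := by
            gcongr
            linarith [Real.exp_one_gt_d9]
    _ = 0.002 := by norm_num

/-- The cut-off `T` and the cap `K` are chosen so that over all `m` runs each fails with probability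
at most `1/1000`; bad estimates add `mλ = 0.01/3`. -/
lemma failure_prob_le {ρ : ℝ} {k m : ℕ} (hρ : 0 < ρ) (hk : 1 ≤ k) (hm : 1 ≤ m) :
    (m : ℝ≥0∞) * ((1 / (⌈1000 * k * m / ρ⌉₊ : ℕ) / ENNReal.ofReal ρ
        + 2 / ((2000 * k * m : ℕ) : ℝ≥0∞)) * k + ENNReal.ofReal (0.01 / (3 * (m : ℝ))))
      ≤ ENNReal.ofReal 0.006 := by
  have hk0 : (0 : ℝ) < k := by exact_mod_cast hk
  have hm0 : (0 : ℝ) < m := by exact_mod_cast hm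
  have hT : 1000 * k * m / ρ ≤ (⌈1000 * k * m / ρ⌉₊ : ℝ) := Nat.le_ceil _
  set T : ℕ := ⌈1000 * k * m / ρ⌉₊
  have hT0 : (0 : ℝ) < T := lt_of_lt_of_le (by positivity) hT
  have hK0 : (0 : ℝ) < ((2000 * k * m : ℕ) : ℝ) := by
    push_cast
    positivity
  have e : (m : ℝ≥0∞) * ((1 / (T : ℝ≥0∞) / ENNReal.ofReal ρ
        + 2 / ((2000 * k * m : ℕ) : ℝ≥0∞)) * k + ENNReal.ofReal (0.01 / (3 * (m : ℝ))))
      = ENNReal.ofReal (m * ((1 / T / ρ + 2 / ((2000 * k * m : ℕ) : ℝ)) * k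
          + 0.01 / (3 * (m : ℝ)))) := by
    rw [ENNReal.ofReal_mul hm0.le, ENNReal.ofReal_add (by positivity) (by positivity),
      ENNReal.ofReal_mul (by positivity), ENNReal.ofReal_add (by positivity) (by positivity),
      ENNReal.ofReal_div_of_pos hρ, ENNReal.ofReal_div_of_pos hT0, ENNReal.ofReal_div_of_pos hK0,
      ENNReal.ofReal_natCast, ENNReal.ofReal_natCast, ENNReal.ofReal_natCast,
      ENNReal.ofReal_natCast]
    simp
  rw [e]
  refine ENNReal.ofReal_le_ofReal ?_
  have h1 : 1 / T / ρ ≤ 1 / (1000 * k * m) := by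
    rw [div_div]
    apply one_div_le_one_div_of_le (by positivity)
    rwa [div_le_iff₀ hρ] at hT
  push_cast
  calc (m : ℝ) * ((1 / T / ρ + 2 / (2000 * k * m)) * k + 0.01 / (3 * m))
      ≤ m * ((1 / (1000 * k * m) + 2 / (2000 * k * m)) * k + 0.01 / (3 * m)) := by gcongr
    _ = 1 / 1000 + 2 / 2000 + 0.01 / 3 := by field_simp
    _ ≤ 0.006 := by norm_num

end Numerics

/-! ### From average bounds for one run to the final guarantee. -/

section Assembly

variable {S : Type u}

lemma le_haltProb_of_averageBounds {M : MarkovModel S} {ρ ε δ x : ℝ} (hH : 1 ≤ M.H)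
    (hρ : 0 < ρ) (hρ1 : ρ < 1) (hδ : 0 < δ) (hδ1 : δ < 1) {k m : ℕ} (hk : 1 ≤ k)
    (hm : m = ⌈30 / δ⌉₊) (hx : 1 ≤ x) {alg : ℕ → Prog (Option (Finset S))}
    {alg' : Prog (Option (Finset S))} {b : ℝ≥0∞}
    (hdom : Dominated alg' (alg ⌈1000 * k * m / ρ⌉₊))
    (hsure : Ensures alg' (SureBounds M ρ ε (13 * (M.H + 1)) 6))
    (hav : AverageBounds alg' ((1 / (⌈1000 * k * m / ρ⌉₊ : ℕ) / ENNReal.ofReal ρ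
        + 2 / ((2000 * k * m : ℕ) : ℝ≥0∞)) * k + ENNReal.ofReal (0.01 / (3 * (m : ℝ))))
      (2 * k) b)
    (hb : m * b ≤ ENNReal.ofReal
      (0.002 * (806000 * sampleBound M.H k ρ ε δ (Real.log x)))) :
    ENNReal.ofReal 0.99 ≤ haltProb (fun fuel => smallestOf (alg fuel) m) fun F cost =>
      escapeProb M (F : Set S) ≤ 2 * ρ + 2 * ε ∧
      (F.card : ℝ) ≤ (2 + δ) * k ∧
      (cost.samples : ℝ) ≤
        30000000 * (k / (δ ^ 2 * ε ^ 2) * Real.log x + M.H * k / (ρ * δ ^ 2)) ∧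
      (cost.steps : ℝ) ≤
        30000000 * (M.H * k / (δ ^ 2 * ε ^ 2) * Real.log x
          + (M.H : ℝ) ^ 2 * k / (ρ * δ ^ 2)) := by
  obtain ⟨hm1, hm2⟩ := natCeil_thirty_div_bounds hδ hδ1
  rw [← hm] at hm1 hm2
  have hk0 : (0 : ℝ) < k := by exact_mod_cast hk
  have hH1 : (1 : ℝ) ≤ M.H := by exact_mod_cast hH
  have hm0 : 1 ≤ m := by
    have : (0 : ℝ) < m := lt_of_lt_of_le (by positivity) hm1
    exact_mod_cast this
  have hY := inv_le_sampleBound (ε := ε) hH hk hρ hρ1 hδ hδ1 (Real.log_nonneg hx)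
  set Y := sampleBound M.H k ρ ε δ (Real.log x) with hYd
  have hδ0 : 0 < 1 / δ := by positivity
  have hY0 : 0 < Y := hδ0.trans_le hY
  refine le_haltProb_smallestOf hdom hsure hav hm0 (t := (2 + δ) * k) (X := 806000 * Y)
    (by positivity) (by positivity) (failure_prob_le hρ hk hm0) (large_prob_le hk hδ hδ1 hm1) hb
    fun F c h1 h2 h3 h4 => ⟨h1, h2, ?_, ?_⟩
  · rw [← sampleBound, ← hYd]
    linarith
  · have e : (M.H : ℝ) * k / (δ ^ 2 * ε ^ 2) * Real.log x + (M.H : ℝ) ^ 2 * k / (ρ * δ ^ 2)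
        = M.H * Y := by
      rw [hYd, sampleBound]
      ring
    rw [e]
    have h5 : (c.steps : ℝ) ≤ 13 * (M.H + 1) * c.samples + (6 + 3) * m := by exact_mod_cast h4
    have hm3 : (m : ℝ) ≤ 31 * (M.H * Y) := by
      calc (m : ℝ) ≤ 31 * (1 * (1 / δ)) := by rw [one_mul, mul_one_div]; exact hm2
        _ ≤ 31 * (M.H * Y) := by gcongr
    -- In total `26 · 806000 + 9 · 31 < 30000000` multiples of `H * Y`.
    have h6 : 13 * ((M.H : ℝ) + 1) * c.samples ≤ 13 * (M.H + M.H) * (806000 * Y) := by gcongr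
    have h7 : 0 ≤ (M.H : ℝ) * Y := by positivity
    linarith

end Assembly

end SafeZone

end

/-! ### The theorem: choice of constants and separation of cases. -/

open SafeZone
theorem mainTheorem1 :
    ∃ a C : ℝ, 0 < a ∧ 0 < C ∧
      ∀ (S : Type u) (M : MarkovModel S) (ρ ε δ : ℝ),
        1 ≤ M.H → 0 < ρ → ρ < 1 → 0 < ε → 0 < δ → δ < 1 →
        ∀ (m : ℕ) (lam k : ℝ),
          m = ⌈a / δ⌉₊ → lam = 0.01 / (3 * (m : ℝ)) → k = (kStar M ρ : ℝ) →
          ((2 * ρ + ε < 1 → 2 * ρ ≤ escapeProb M {M.s₀}) →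
            ENNReal.ofReal 0.99 ≤
              haltProb (fun fuel => smallestOf (findSafeZone M ρ ε lam fuel) m)
                (fun F cost =>
                  escapeProb M (F : Set S) ≤ 2 * ρ + 2 * ε ∧
                  (F.card : ℝ) ≤ (2 + δ) * k ∧
                  (cost.samples : ℝ) ≤
                    C * (k / (δ ^ 2 * ε ^ 2) * Real.log (k / δ) + M.H * k / (ρ * δ ^ 2)) ∧
                  (cost.steps : ℝ) ≤
                    C * (M.H * k / (δ ^ 2 * ε ^ 2) * Real.log (k / δ)
                      + (M.H : ℝ) ^ 2 * k / (ρ * δ ^ 2)))) ∧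
          ENNReal.ofReal 0.99 ≤
            haltProb (fun fuel => smallestOf (findSafeZoneEst M ρ ε lam fuel) m)
              (fun F cost =>
                escapeProb M (F : Set S) ≤ 2 * ρ + 2 * ε ∧
                (F.card : ℝ) ≤ (2 + δ) * k ∧
                (cost.samples : ℝ) ≤
                  C * (k / (δ ^ 2 * ε ^ 2) * Real.log (2 * k / δ) + M.H * k / (ρ * δ ^ 2)) ∧
                (cost.steps : ℝ) ≤
                  C * (M.H * k / (δ ^ 2 * ε ^ 2) * Real.log (2 * k / δ)
                    + (M.H : ℝ) ^ 2 * k / (ρ * δ ^ 2))) := by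
  refine ⟨30, 30000000, by norm_num, by norm_num, ?_⟩
  rintro S M ρ ε δ hH hρ hρ1 hε hδ hδ1 m _ _ hm rfl rfl
  obtain ⟨G, hG, hGk⟩ := exists_isSafe_card_eq_kStar M hρ
  have hs₀ : M.s₀ ∈ G := by simpa using initial_mem_of_isSafe hρ1 hG
  have hk : 1 ≤ kStar M ρ := hGk ▸ Finset.card_pos.2 ⟨_, hs₀⟩
  obtain ⟨hm1, hm2⟩ := natCeil_thirty_div_bounds hδ hδ1
  rw [← hm] at hm1 hm2
  have hm0 : 0 < (m : ℝ) := lt_of_lt_of_le (by positivity) hm1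
  have hm0' : 1 ≤ m := by exact_mod_cast hm0
  have hk0 : (1 : ℝ) ≤ kStar M ρ := by exact_mod_cast hk
  have hlam : 0 < 0.01 / (3 * (m : ℝ)) := by positivity
  have hK : 0 < 2000 * kStar M ρ * m := by positivity
  have hT : 0 < ⌈1000 * (kStar M ρ : ℝ) * m / ρ⌉₊ := Nat.ceil_pos.2 (by positivity)
  have hkδ : (kStar M ρ : ℝ) ≤ kStar M ρ / δ := by
    rw [le_div_iff₀ hδ]
    nlinarith
  constructor
  · intro h₀
    by_cases hloop : 2 * ρ + ε < 1
    -- If `k = 1` then `G = {s₀}`, which would be `ρ`-safe although `Δ({s₀}) ≥ 2ρ`. This yields `k/δ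
    -- ≥ 2`, as the logarithm requires.
    · have hk2 : 2 ≤ kStar M ρ := by
        by_contra hlt
        have h1 : G.card = 1 := by omega
        obtain ⟨s, rfl⟩ := Finset.card_eq_one.1 h1
        obtain rfl := Finset.mem_singleton.1 hs₀
        have : escapeProb M (({M.s₀} : Finset S) : Set S) ≤ ρ := hG
        rw [Finset.coe_singleton] at this
        linarith [h₀ hloop]
      have hk2' : (2 : ℝ) ≤ kStar M ρ := by exact_mod_cast hk2
      have hav := averageBounds_of_val_le hs₀ fun w₁ w₂ w₃ a hw₁ hw₂ hw₃ ha =>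
        val_guardedFind_le hρ hε hlam hG hK hT hw₁ hw₂ hw₃ ha h₀
      rw [hGk] at hav
      exact le_haltProb_of_averageBounds hH hρ hρ1 hδ hδ1 hk hm (by linarith)
        (dominated_guardedFind M ρ ε _ _ _) (ensures_guardedFind M _ _ hε) hav
        (expected_samples_le hH hk hm0' hm2 hρ hρ1 hε hδ hδ1 (hk2'.trans hkδ) le_rfl)
    -- The loop body is never entered and nothing is sampled, so `k/δ` may be close to `1`; only a
    -- nonnegative logarithm is needed.
    · refine le_haltProb_of_averageBounds hH hρ hρ1 hδ hδ1 hk hm (hk0.trans hkδ)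
        (dominated_guardedFind M ρ ε _ (2000 * kStar M ρ * m) _) (ensures_guardedFind M _ _ hε)
        (b := 0) ⟨?_, ?_, ?_⟩ (by simp)
      · rw [val_guardedFind_of_one_le M _ hT (not_lt.1 hloop)]
        simp [outVal]
      · rw [val_guardedFind_of_one_le M _ hT (not_lt.1 hloop)]
        simp only [outVal, Finset.card_singleton, Nat.cast_one, mul_one]
        exact_mod_cast (by omega : 1 ≤ 2 * kStar M ρ)
      · rw [val_guardedFind_of_one_le M _ hT (not_lt.1 hloop)]
        simp [outVal]
  · have hav := averageBounds_of_val_le hs₀ fun w₁ w₂ w₃ a hw₁ hw₂ hw₃ ha =>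
      val_guardedFindEst_le hρ hε hlam hG hK hT hw₁ hw₂ hw₃ ha
    rw [hGk] at hav
    have hx : (kStar M ρ : ℝ) / δ ≤ 2 * kStar M ρ / δ := by
      gcongr
      linarith
    -- The factor `2` in the logarithm covers `k = 1`, where samples are still spent on the initial
    -- estimate.
    have hx2 : (2 : ℝ) ≤ 2 * kStar M ρ / δ := by
      rw [mul_div_assoc]
      linarith
    exact le_haltProb_of_averageBounds hH hρ hρ1 hδ hδ1 hk hm (by linarith)
      (dominated_guardedFindEst M ρ ε _ _ _) (ensures_guardedFindEst M _ _) hav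
      (expected_samples_le hH hk hm0' hm2 hρ hρ1 hε hδ hδ1 hx2 hx)
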